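/- Let $\mathcal H$ be a real Hilbert space, $n\ge 2$ and $m\ge 0$ integers; $\mathcal H^p$ carries the product Hilbert structure. Let $F_1,\dots,F_n:\mathcal H\rightrightarrows\mathcal H$ be maximally monotone and let $B_i:\mathcal H\to\mathcal H$ be $\frac1{L_i}$-cocoercive with $L_i>0$, i.e. $\langle B_ix-B_iy,x-y\rangle\ge\frac1{L_i}\|B_ix-B_iy\|^2$, $i=1,\dots,m$, and suppose that $\operatorname{zer}\big(\sum_{i=1}^nF_i+\sum_{i=1}^mB_i\big)\ne\emptyset$. For an operator $A$ write $J_A=(\mathrm{Id}+A)^{-1}$. Put $L=\operatorname{diag}(\frac1{L_1},\dots,\frac1{L_m})$, $e_p=(1,\dots,1)^\top\in\mathbb R^p$ and $\|\mathbf u\|_{\mathbf L^{-1}}^2=\sum_{j=1}^mL_j\|u_j\|^2$. Parameters. Let $\varepsilon>0$, $\theta>0$ and let $\gamma_k,\xi_k$ $(k\ge0)$ be real numbers with $\varepsilon\le\gamma_k\le1-\varepsilon$ and $0\le\xi_k\le1-\varepsilon$. Matrices. Let $M\in\mathbb R^{n\times(n-1)}$, $S\in\mathbb R^{n\times n}$,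 $C\in\mathbb R^{n\times m}$, $Q\in\mathbb R^{m\times n}$ satisfy: (a) $\ker M^\top\subseteq\mathbb Re_n$; (b) $C^\top e_n=Qe_n=e_m$, and $C,Q^\top$ are causal: there are integers $0=A_1\le A_2\le\dots\le A_n=m$ such that $C_{ij}=0$ whenever $j>A_i$ and $Q_{ji}=0$ whenever $j\le A_i$; (c) $S$ is symmetric, $e_n^\top Se_n=0$, and $S-MM^\top-\frac12(1+\frac1\theta)(C^\top-Q)^\top L^{-1}(C^\top-Q)$ is positive semidefinite. Then every $S_{ii}$ is positive; put $d_i=2/S_{ii}$. Algorithm. Let $\mathbf z^0\in\mathcal H^{n-1}$ be arbitrary, $\mathbf u^0=0\in\mathcal H^m$, $\mathbf v^0=0\in\mathcal H^{n-1}$, and for all $k\ge0$ let $$x_i^k=J_{d_iF_i}\Big(-d_i\sum_{j=1}^{i-1}S_{ij}x_j^k+d_i\sum_{j=1}^{n-1}M_{ij}(z_j^k+v_j^k)-d_i\sum_{j=1}^mC_{ij}B_j\Big(\sum_{h=1}^{i-1}Q_{jh}x_h^k+u_j^k\Big)\Big),\quad i=1,\dots,n,$$ $$z_i^{k+1}=z_i^k-\gamma_k\sum_{j=1}^nM_{ji}x_j^k,\quad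 i=1,\dots,n-1,$$ where the deviations $\mathbf u^{k+1}\in\mathcal H^m$, $\mathbf v^{k+1}\in\mathcal H^{n-1}$ are any vectors satisfying $$\frac{\gamma_{k+1}}{1-\gamma_{k+1}}\|\mathbf v^{k+1}\|^2+\frac{\gamma_{k+1}(1+\theta)}2\|\mathbf u^{k+1}\|_{\mathbf L^{-1}}^2\le\xi_kl_k^2,\qquad l_k^2=\frac{1-\gamma_k}{\gamma_k}\Big\|\mathbf z^{k+1}-\mathbf z^k+\frac{\gamma_k}{1-\gamma_k}\mathbf v^k\Big\|^2 .$$ Operator. Let $\gamma>0$, $D=\operatorname{diag}(d_1,\dots,d_n)$, let $N$ be minus the strictly lower triangular part of $S$, write $\mathbf P=P\otimes\mathrm{Id}$ for a real matrix $P$, $\mathbf F(\mathbf x)=F_1(x_1)\times\dots\times F_n(x_n)$, $\mathbf B(\mathbf y)=(B_1y_1,\dots,B_my_m)$, and define $T$ on $\mathcal H^{n-1}$ by $$T(\mathbf z)=\mathbf z-\gamma\mathbf M^*\mathbf x,\qquad\mathbf x=J_{\mathbf{DF}}\big(\mathbf{DN}\mathbf x+\mathbf{DM}\mathbf z-\mathbf{DC}\,\mathbf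 B(\mathbf{Qx})\big).$$ Then: (i) $\sum_kl_k^2<\infty$, $\mathbf u^k\to0$ and $\mathbf v^k\to0$; (ii) for every $\mathbf z\in\operatorname{Fix}T$ the sequence $\|\mathbf z^k-\mathbf z\|$ converges; (iii) $\mathbf z^{k+1}-\mathbf z^k\to0$, and $\sum_{i=1}^ns_ix_i^k\to0$ for every $s\in\mathbb R^n$ with $\sum_{i=1}^ns_i=0$; (iv) $\mathbf z^k$ converges weakly to a point of $\operatorname{Fix}T$; (v) $\mathbf x^k=(x_1^k,\dots,x_n^k)$ converges weakly to $(\bar x,\dots,\bar x)$ for some $\bar x\in\operatorname{zer}\big(\sum_{i=1}^nF_i+\sum_{i=1}^mB_i\big)$. -/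

import Mathlib

open Filter Topology
open scoped Pointwise Matrix

noncomputable section

namespace DeviationFBS

/-! ### Set-valued operators -/

section Operators

variable {E : Type*} [NormedAddCommGroup E] [InnerProductSpace ℝ E]

/-- A set-valued operator `A : E ⇉ E` is maximally monotone: `(x, u)` belongs to its graph
if and only if `⟪u - v, x - y⟫ ≥ 0` for every `(y, v)` in the graph. -/
def MaximallyMonotone (A : E → Set E) : Prop :=
  ∀ x u : E, u ∈ A x ↔ ∀ y v : E, v ∈ A y → 0 ≤ inner ℝ (u - v) (x - y)

/-- A single-valued operator is `c`-cocoercive. -/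
def Cocoercive (c : ℝ) (B : E → E) : Prop :=
  ∀ x y : E, c * ‖B x - B y‖ ^ 2 ≤ inner ℝ (B x - B y) (x - y)

/-- A single-valued operator seen as a set-valued one. -/
def singleValued (B : E → E) : E → Set E := fun x => {B x}

/-- The zeros of a set-valued operator. -/
def zer (A : E → Set E) : Set E := {x | 0 ∈ A x}

/-- The resolvent `J_A = (Id + A)⁻¹` as a set-valued operator: `x ∈ J_A y` if and only if
`y ∈ x + A x`. For a maximally monotone `A` it is single-valued with full domain, and
`x ∈ resolvent A y` reads `x = J_A y`. -/
def resolvent (A : E → Set E) : E → Set E := fun y => {x | y ∈ ({x} : Set E) + A x}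

/-- Weak convergence of a sequence. -/
def WeaklyConverges (x : ℕ → E) (a : E) : Prop :=
  Tendsto (fun k => toWeakSpace ℝ E (x k)) atTop (𝓝 (toWeakSpace ℝ E a))

end Operators

/-! ### Product spaces and Kronecker operators -/

/-- The Hilbert product space `H ^ p`. -/
abbrev HilbertPow (H : Type*) (p : ℕ) : Type _ := PiLp 2 (fun _ : Fin p => H)

section ProductSpace

variable {H : Type*} [NormedAddCommGroup H] [InnerProductSpace ℝ H]

/-- The operator `P ⊗ Id : H ^ q → H ^ p` of a `p × q` matrix `P`. Its adjoint is `kron Pᵀ`. -/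
def kron {p q : ℕ} (P : Matrix (Fin p) (Fin q) ℝ) (x : HilbertPow H q) : HilbertPow H p :=
  WithLp.toLp 2 fun i => ∑ j, P i j • x j

/-- The set-valued operator `(x₁, …, x_p) ↦ F₁ x₁ × ⋯ × F_p x_p`. -/
def prodSet {p : ℕ} (F : Fin p → H → Set H) : HilbertPow H p → Set (HilbertPow H p) :=
  fun x => {f | ∀ i, f i ∈ F i (x i)}

/-- The operator `(y₁, …, y_p) ↦ (B₁ y₁, …, B_p y_p)`. -/
def prodMap {p : ℕ} (B : Fin p → H → H) (y : HilbertPow H p) : HilbertPow H p :=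
  WithLp.toLp 2 fun j => B j (y j)

/-- The squared norm `‖u‖²_W = ⟪u, (W ⊗ Id) u⟫` on `H ^ p`. -/
def weightedNormSq {p : ℕ} (W : Matrix (Fin p) (Fin p) ℝ) (u : HilbertPow H p) : ℝ :=
  inner ℝ u (kron W u)

end ProductSpace

/-! ### Matrices and parameters -/

/-- The pair `C, Qᵀ` of `n × m` matrices is causal: there is a nondecreasing vector
`A ∈ {0, …, m}ⁿ` with first entry `0` and last entry `m` such that (with 1-based column
indices `j`) `C i j = 0` for `j > A i` and `Qᵀ i j = 0` for `j ≤ A i`. The column with the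
0-based index `j : Fin m` is column number `j + 1`. -/
def Causal {n m : ℕ} (C : Matrix (Fin n) (Fin m) ℝ) (Q : Matrix (Fin m) (Fin n) ℝ) : Prop :=
  ∃ A : Fin n → Fin (m + 1), Monotone A ∧
    (∀ i : Fin n, (i : ℕ) = 0 → A i = 0) ∧
    (∀ i : Fin n, (i : ℕ) + 1 = n → A i = Fin.last m) ∧
    (∀ (i : Fin n) (j : Fin m), (A i : ℕ) < (j : ℕ) + 1 → C i j = 0) ∧
    (∀ (i : Fin n) (j : Fin m), (j : ℕ) + 1 ≤ (A i : ℕ) → Qᵀ i j = 0)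

/-- The diagonal matrix `L⁻¹ = diag(L₁, …, L_m)`, the inverse of `diag(1/L₁, …, 1/L_m)`. -/
def Linv {m : ℕ} (Lc : Fin m → ℝ) : Matrix (Fin m) (Fin m) ℝ := Matrix.diagonal Lc

/-- The conditions on the scalar parameters. -/
structure ParameterAssumption (ε θ : ℝ) (γ ξ : ℕ → ℝ) : Prop where
  eps_pos : 0 < ε
  theta_pos : 0 < θ
  gamma_mem : ∀ k, ε ≤ γ k ∧ γ k ≤ 1 - ε
  xi_mem : ∀ k, 0 ≤ ξ k ∧ ξ k ≤ 1 - ε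

/-- The conditions on the matrices `M, S, C, Q`. -/
structure MatrixAssumption {n m : ℕ} (θ : ℝ) (Lc : Fin m → ℝ)
    (M : Matrix (Fin n) (Fin (n - 1)) ℝ) (S : Matrix (Fin n) (Fin n) ℝ)
    (C : Matrix (Fin n) (Fin m) ℝ) (Q : Matrix (Fin m) (Fin n) ℝ) : Prop where
  ker_le : LinearMap.ker (Mᵀ).mulVecLin ≤ Submodule.span ℝ {(fun _ => 1 : Fin n → ℝ)}
  causal : Causal C Q
  C_ones : Cᵀ *ᵥ (fun _ => 1) = fun _ => 1
  Q_ones : Q *ᵥ (fun _ => 1) = fun _ => 1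
  S_symm : S.IsSymm
  S_ones : (fun _ => 1) ⬝ᵥ (S *ᵥ (fun _ => 1)) = 0
  S_ge : (S - M * Mᵀ -
    ((1 / 2 : ℝ) * (1 + 1 / θ)) • ((Cᵀ - Q)ᵀ * Linv Lc * (Cᵀ - Q))).PosSemidef

/-- The step sizes `(d₁, …, d_n)`, where `d_i = 2 / S_ii`. -/
def stepSize {n : ℕ} (S : Matrix (Fin n) (Fin n) ℝ) (i : Fin n) : ℝ := 2 * (S i i)⁻¹

/-- The matrix `N`, minus the strictly lower triangular part of `S`. -/
def negLower {n : ℕ} (S : Matrix (Fin n) (Fin n) ℝ) : Matrix (Fin n) (Fin n) ℝ :=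
  Matrix.of fun i j => if j < i then -S i j else 0

/-! ### The operator `T` and the algorithm -/

section Algorithm

variable {H : Type*} [NormedAddCommGroup H] [InnerProductSpace ℝ H] {n m : ℕ}

/-- The operator `T z = z - γ M* x` on `H ^ (n-1)`, where `x = J_{DF}(DN x + DM z - DCB(Q x))`.
It is written as a set-valued operator, in the same way as the resolvent through which it is
defined. -/
def opT (F : Fin n → H → Set H) (B : Fin m → H → H)
    (M : Matrix (Fin n) (Fin (n - 1)) ℝ) (S : Matrix (Fin n) (Fin n) ℝ)
    (C : Matrix (Fin n) (Fin m) ℝ) (Q : Matrix (Fin m) (Fin n) ℝ) (γ : ℝ)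
    (z : HilbertPow H (n - 1)) : Set (HilbertPow H (n - 1)) :=
  let D : Matrix (Fin n) (Fin n) ℝ := Matrix.diagonal (stepSize S)
  {w | ∃ x : HilbertPow H n,
    x ∈ resolvent (prodSet fun i => stepSize S i • F i)
      (kron (D * negLower S) x + kron (D * M) z - kron (D * C) (prodMap B (kron Q x))) ∧
    w = z - γ • kron Mᵀ x}

/-- The fixed points of a (set-valued) operator. -/
def fixedPts {X : Type*} (T : X → Set X) : Set X := {z | z ∈ T z}

/-- The quantity `l_k² = (1 - γ_k) / γ_k * ‖z^{k+1} - z^k + γ_k / (1 - γ_k) v^k‖²`. -/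
def lSq (γ : ℕ → ℝ) (z v : ℕ → HilbertPow H (n - 1)) (k : ℕ) : ℝ :=
  (1 - γ k) / γ k * ‖z (k + 1) - z k + (γ k / (1 - γ k)) • v k‖ ^ 2

/-- `x, z` are generated by the frugal forward-backward method with the deviations `u, v`. -/
structure IsGenerated (F : Fin n → H → Set H) (B : Fin m → H → H) (Lc : Fin m → ℝ)
    (M : Matrix (Fin n) (Fin (n - 1)) ℝ) (S : Matrix (Fin n) (Fin n) ℝ)
    (C : Matrix (Fin n) (Fin m) ℝ) (Q : Matrix (Fin m) (Fin n) ℝ)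
    (θ : ℝ) (γ ξ : ℕ → ℝ)
    (x : ℕ → HilbertPow H n) (z : ℕ → HilbertPow H (n - 1))
    (u : ℕ → HilbertPow H m) (v : ℕ → HilbertPow H (n - 1)) : Prop where
  u_zero : u 0 = 0
  v_zero : v 0 = 0
  x_step : ∀ (k : ℕ) (i : Fin n),
    x k i ∈ resolvent (stepSize S i • F i)
      (-(stepSize S i • ∑ j ∈ Finset.Iio i, S i j • x k j)
        + stepSize S i • ∑ j : Fin (n - 1), M i j • (z k j + v k j)
        - stepSize S i • ∑ j : Fin m,
            C i j • B j (∑ h ∈ Finset.Iio i, Q j h • x k h + u k j))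
  z_step : ∀ (k : ℕ) (i : Fin (n - 1)),
    z (k + 1) i = z k i - γ k • ∑ j : Fin n, M j i • x k j
  deviation_le : ∀ k : ℕ,
    γ (k + 1) / (1 - γ (k + 1)) * ‖v (k + 1)‖ ^ 2
      + γ (k + 1) * (1 + θ) / 2 * weightedNormSq (Linv Lc) (u (k + 1)) ≤ ξ k * lSq γ z v k

end Algorithm

end DeviationFBS

end

open DeviationFBS

/-! Since `D⁻¹` is half the diagonal of `S`, each resolvent step is the inclusion `(N - D⁻¹) x + M
(z + v) - C B(Q x + u) ∈ F(x)`, and causality is what makes it explicit. Here `N - D⁻¹`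
(`lowerHalf`) has symmetric part `-S / 2`. The kernel of `Mᵀ` is the line of constants and the range
of `M` is the space of sum-zero vectors. So a fixed point `p` of `T` is a vector for which some
diagonal `x = (a, …, a)` solves the undisturbed inclusion (`IsSol`). Summing its rows shows that `a`
is a zero, and every zero arises this way.

Descent: subtract the inclusion at a solution from the one at an iterate. Monotonicity yields `-S /
2`, while cocoercivity leaves an error from `Cᵀ - Q`, which Young's inequality and the lower bound
on `S` absorb (`IsSol.norm_sq_le`). This gives `‖z^{k+1} - p‖² ≤ ‖z^k - p‖² - l_k² + e_k`, with
`e_k` the deviation size. Since `e_{k+1} ≤ (1 - ε) l_k²`, the quantity `‖z^k - p‖² + e_k` is a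
Lyapunov function, whence summability, vanishing deviations and convergent distances.

Cluster points: `Mᵀ x^k → 0` makes all blocks agree asymptotically, so weak limits of `x^k` are
diagonal. Both the `F i` and the `B j` are passed to the limit as one monotone family; the required
convergence of inner products comes from `inner_dual_identity`, where each term pairs a bounded
sequence with a strongly null one (`exists_isSol_of_weakLim`). Opial's lemma gives the limit of
`z^k`. The first row determines `a` from `p`, so all of `x^k` converges weakly. -/

noncomputable section

namespace DeviationFBS

/-! ### Calculus of Kronecker operators -/

section Kron

variable {H : Type*} [NormedAddCommGroup H] [InnerProductSpace ℝ H] {p q r : ℕ}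

@[simp]
theorem kron_apply (P : Matrix (Fin p) (Fin q) ℝ) (x : HilbertPow H q) (i : Fin p) :
    kron P x i = ∑ j, P i j • x j := rfl

/-- `kron P` as a continuous linear map. -/
def kronCLM (P : Matrix (Fin p) (Fin q) ℝ) : HilbertPow H q →L[ℝ] HilbertPow H p where
  toFun := kron P
  map_add' x y := by
    ext i
    simp [smul_add, Finset.sum_add_distrib]
  map_smul' c x := by
    ext i
    simp [Finset.smul_sum, smul_comm c]
  cont := by
    unfold kron
    fun_prop

theorem kron_sub (P : Matrix (Fin p) (Fin q) ℝ) (x y : HilbertPow H q) :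
    kron P (x - y) = kron P x - kron P y := map_sub (kronCLM P) x y

theorem kron_zero (P : Matrix (Fin p) (Fin q) ℝ) : kron P (0 : HilbertPow H q) = 0 :=
  map_zero (kronCLM P)

theorem continuous_kron (P : Matrix (Fin p) (Fin q) ℝ) :
    Continuous (kron P : HilbertPow H q → HilbertPow H p) := (kronCLM P).continuous

theorem add_kron (P P' : Matrix (Fin p) (Fin q) ℝ) (x : HilbertPow H q) :
    kron (P + P') x = kron P x + kron P' x := by
  ext i
  simp [add_smul, Finset.sum_add_distrib]

theorem sub_kron (P P' : Matrix (Fin p) (Fin q) ℝ) (x : HilbertPow H q) :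
    kron (P - P') x = kron P x - kron P' x := by
  ext i
  simp [sub_smul, Finset.sum_sub_distrib]

theorem smul_kron (c : ℝ) (P : Matrix (Fin p) (Fin q) ℝ) (x : HilbertPow H q) :
    kron (c • P) x = c • kron P x := by
  ext i
  simp [Finset.smul_sum, mul_smul]

theorem one_kron (x : HilbertPow H p) : kron (1 : Matrix (Fin p) (Fin p) ℝ) x = x := by
  ext i
  simp [Matrix.one_apply, ite_smul]

theorem mul_kron (P : Matrix (Fin p) (Fin q) ℝ) (P' : Matrix (Fin q) (Fin r) ℝ)
    (x : HilbertPow H r) : kron (P * P') x = kron P (kron P' x) := by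
  ext i
  simp only [kron_apply, Matrix.mul_apply, Finset.sum_smul, Finset.smul_sum, mul_smul]
  exact Finset.sum_comm

theorem inner_kron (P : Matrix (Fin p) (Fin q) ℝ) (x : HilbertPow H q) (y : HilbertPow H p) :
    inner ℝ (kron P x) y = inner ℝ x (kron Pᵀ y) := by
  simp only [PiLp.inner_apply, kron_apply, sum_inner, inner_sum, Matrix.transpose_apply,
    real_inner_smul_left, real_inner_smul_right]
  exact Finset.sum_comm

open scoped MatrixOrder Matrix.Norms.L2Operator in
theorem inner_kron_self_nonneg {P : Matrix (Fin p) (Fin p) ℝ} (hP : P.PosSemidef)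
    (x : HilbertPow H p) : 0 ≤ inner ℝ x (kron P x) := by
  -- Writing `P = Rᵀ R` turns the form on blocks into `‖(R ⊗ Id) x‖²`.
  obtain ⟨R, rfl⟩ := CStarAlgebra.nonneg_iff_eq_star_mul_self.mp hP.nonneg
  rw [Matrix.star_eq_conjTranspose, Matrix.conjTranspose_eq_transpose_of_trivial, mul_kron,
    ← inner_kron]
  exact real_inner_self_nonneg

/-- The vector `(a, …, a)`. -/
def diagVec {X : Type*} (p : ℕ) (a : X) : HilbertPow X p := WithLp.toLp 2 fun _ => a

@[simp]
theorem diagVec_apply {X : Type*} (a : X) (i : Fin p) : diagVec p a i = a := rfl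

theorem kron_diagVec_eq_zero {P : Matrix (Fin p) (Fin q) ℝ} (hP : P *ᵥ (fun _ => 1) = 0)
    (a : H) : kron P (diagVec q a) = 0 := by
  ext i
  have := congrFun hP i
  simp only [Matrix.mulVec, dotProduct, mul_one, Pi.zero_apply] at this
  simp [← Finset.sum_smul, this]

theorem kron_diagVec {P : Matrix (Fin p) (Fin q) ℝ} (hP : P *ᵥ (fun _ => 1) = fun _ => 1)
    (a : H) : kron P (diagVec q a) = diagVec p a := by
  ext i
  have := congrFun hP i
  simp only [Matrix.mulVec, dotProduct, mul_one] at this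
  simp [← Finset.sum_smul, this]

theorem sum_kron {P : Matrix (Fin p) (Fin q) ℝ} {c : ℝ} (hP : Pᵀ *ᵥ (fun _ => 1) = fun _ => c)
    (x : HilbertPow H q) : ∑ i, kron P x i = c • ∑ j, x j := by
  simp only [kron_apply]
  rw [Finset.sum_comm, Finset.smul_sum]
  refine Finset.sum_congr rfl fun j _ => ?_
  have := congrFun hP j
  simp only [Matrix.mulVec, dotProduct, mul_one, Matrix.transpose_apply] at this
  rw [← Finset.sum_smul, this]

theorem weightedNormSq_Linv (Lc : Fin p → ℝ) (u : HilbertPow H p) :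
    weightedNormSq (Linv Lc) u = ∑ j, Lc j * ‖u j‖ ^ 2 := by
  simp [weightedNormSq, Linv, PiLp.inner_apply, Matrix.diagonal_apply, ite_smul,
    real_inner_smul_right]

end Kron

/-! ### Consequences of the matrix conditions -/

section MatrixFacts

variable {n m : ℕ} {θ : ℝ} {Lc : Fin m → ℝ} {M : Matrix (Fin n) (Fin (n - 1)) ℝ}
  {S : Matrix (Fin n) (Fin n) ℝ} {C : Matrix (Fin n) (Fin m) ℝ} {Q : Matrix (Fin m) (Fin n) ℝ}

theorem MatrixAssumption.sub_ones (h : MatrixAssumption θ Lc M S C Q) :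
    (Cᵀ - Q) *ᵥ (fun _ => 1) = 0 := by
  rw [Matrix.sub_mulVec, h.C_ones, h.Q_ones, sub_self]

theorem posSemidef_gram (hθ : 0 < θ) (hLc : ∀ j, 0 < Lc j) (E : Matrix (Fin m) (Fin n) ℝ) :
    (((1 / 2 : ℝ) * (1 + 1 / θ)) • (Eᵀ * Linv Lc * E)).PosSemidef := by
  have h : (Linv Lc).PosSemidef := Matrix.PosSemidef.diagonal fun j => (hLc j).le
  have := h.conjTranspose_mul_mul_same E
  rw [Matrix.conjTranspose_eq_transpose_of_trivial] at this
  exact this.smul (by positivity)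

theorem dotProduct_mul_transpose {p q : ℕ} (M : Matrix (Fin p) (Fin q) ℝ) (s : Fin p → ℝ) :
    s ⬝ᵥ ((M * Mᵀ) *ᵥ s) = (Mᵀ *ᵥ s) ⬝ᵥ (Mᵀ *ᵥ s) := by
  rw [← Matrix.mulVec_mulVec, Matrix.dotProduct_mulVec, ← Matrix.mulVec_transpose]

/-- Evaluated at the vector of ones, the semidefinite form in `S_ge` reduces to `-‖Mᵀ e‖²`, so this
must vanish. -/
theorem MatrixAssumption.M_ones (h : MatrixAssumption θ Lc M S C Q) :
    Mᵀ *ᵥ (fun _ => 1) = 0 := by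
  have h1 := h.S_ge.dotProduct_mulVec_nonneg (fun _ => 1)
  have h2 : star (fun _ : Fin n => (1 : ℝ)) = fun _ => 1 := by ext; simp
  rw [h2, Matrix.sub_mulVec, Matrix.sub_mulVec, Matrix.smul_mulVec,
    ← Matrix.mulVec_mulVec _ _ (Cᵀ - Q), h.sub_ones, Matrix.mulVec_zero, smul_zero, sub_zero, dotProduct_sub, h.S_ones,
    dotProduct_mul_transpose] at h1
  have h3 : 0 ≤ (Mᵀ *ᵥ fun _ => 1) ⬝ᵥ (Mᵀ *ᵥ fun _ => 1) :=
    Finset.sum_nonneg fun i _ => mul_self_nonneg _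
  exact dotProduct_self_eq_zero.mp (by linarith)

/-- A semidefinite matrix annihilates every vector on which its form vanishes; on the ones vector
the matrix of `S_ge` acts as `S`. -/
theorem MatrixAssumption.S_mulVec_ones (h : MatrixAssumption θ Lc M S C Q) :
    S *ᵥ (fun _ => 1) = 0 := by
  have h2 : star (fun _ : Fin n => (1 : ℝ)) = fun _ => 1 := by ext; simp
  have key : (S - M * Mᵀ - ((1 / 2 : ℝ) * (1 + 1 / θ)) • ((Cᵀ - Q)ᵀ * Linv Lc * (Cᵀ - Q))) *ᵥ
      (fun _ => 1) = S *ᵥ (fun _ => 1) := by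
    rw [Matrix.sub_mulVec, Matrix.sub_mulVec, Matrix.smul_mulVec, ← Matrix.mulVec_mulVec,
      ← Matrix.mulVec_mulVec, h.sub_ones, h.M_ones]
    simp
  have := (h.S_ge.dotProduct_mulVec_zero_iff (fun _ => 1)).mp (by rw [key, h2, h.S_ones])
  rwa [key] at this

/-- `S i i` dominates the squared norm of row `i` of `M`. A zero row would put a coordinate vector
into `ker Mᵀ`, whose elements are constant. -/
theorem MatrixAssumption.S_diag_pos (h : MatrixAssumption θ Lc M S C Q) (hn : 2 ≤ n)
    (hθ : 0 < θ) (hLc : ∀ j, 0 < Lc j) (i : Fin n) : 0 < S i i := by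
  have h1 : (S - M * Mᵀ).PosSemidef := by
    simpa using h.S_ge.add (posSemidef_gram hθ hLc (Cᵀ - Q))
  have h2 := h1.diag_nonneg (i := i)
  rw [Matrix.sub_apply, sub_nonneg] at h2
  refine lt_of_lt_of_le ?_ h2
  have h3 : (M * Mᵀ) i i = ∑ j, M i j * M i j := by simp [Matrix.mul_apply]
  rw [h3]
  refine lt_of_le_of_ne (Finset.sum_nonneg fun j _ => mul_self_nonneg _) fun h0 => ?_
  have h4 : ∀ j, M i j = 0 := fun j => by
    have := (Finset.sum_eq_zero_iff_of_nonneg fun j _ => mul_self_nonneg (M i j)).mp h0.symm j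
      (Finset.mem_univ j)
    exact mul_self_eq_zero.mp this
  have h5 : Pi.single i (1 : ℝ) ∈ LinearMap.ker (Mᵀ).mulVecLin := by
    ext j
    simp [h4]
  obtain ⟨c, hc⟩ := Submodule.mem_span_singleton.mp (h.ker_le h5)
  have hnt : Nontrivial (Fin n) := Fin.nontrivial_iff_two_le.mpr hn
  obtain ⟨l, hl⟩ := exists_ne i
  have h6 := congrFun hc i
  have h7 := congrFun hc l
  simp [hl] at h6 h7
  simp [h6] at h7

/-- A matrix `R` for which `M R` is the orthogonal projection onto the vectors of sum zero. -/
theorem MatrixAssumption.exists_right_inverse (h : MatrixAssumption θ Lc M S C Q) (hn : 2 ≤ n) :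
    ∃ R : Matrix (Fin (n - 1)) (Fin n) ℝ,
      M * R = 1 - (n : ℝ)⁻¹ • Matrix.of fun _ _ => (1 : ℝ) := by
  have hn0 : (n : ℝ) ≠ 0 := by positivity
  -- The range of `M` contains all sum-zero vectors: the functional `s ⬝ᵥ ·` vanishes on the common
  -- kernel of the columns of `M`, which consists of constants, so it is a combination of those
  -- columns.
  have key : ∀ s : Fin n → ℝ, ∑ i, s i = 0 → ∃ t : Fin (n - 1) → ℝ, M *ᵥ t = s := by
    intro s hs
    have hle : (⨅ j, LinearMap.ker (LinearMap.proj j ∘ₗ (Mᵀ).mulVecLin)) ≤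
        LinearMap.ker (dotProductBilin ℝ ℝ s) := by
      intro w hw
      have hw' : w ∈ LinearMap.ker (Mᵀ).mulVecLin := by
        ext j
        exact (Submodule.mem_iInf _).mp hw j
      obtain ⟨c, rfl⟩ := Submodule.mem_span_singleton.mp (h.ker_le hw')
      simp [dotProduct, hs]
    obtain ⟨t, ht⟩ := Submodule.mem_span_range_iff_exists_fun ℝ |>.mp
      (mem_span_of_iInf_ker_le_ker hle)
    refine ⟨t, funext fun i => ?_⟩
    have := LinearMap.congr_fun ht (Pi.single i 1)
    simpa [Matrix.mulVec, dotProduct, mul_comm, Pi.single_apply] using this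
  choose t ht using fun l : Fin n => key (fun i => (1 : Matrix (Fin n) (Fin n) ℝ) i l - (n : ℝ)⁻¹)
    (by simp [Matrix.one_apply, hn0])
  refine ⟨Matrix.of fun j l => t l j, ?_⟩
  ext i l
  simpa [Matrix.mulVec, dotProduct, Matrix.mul_apply] using congrFun (ht l) i

end MatrixFacts

/-! ### Monotone operators -/

section Monotone

variable {E : Type*} [NormedAddCommGroup E] [InnerProductSpace ℝ E]

theorem MaximallyMonotone.inner_nonneg {A : E → Set E} (hA : MaximallyMonotone A) {x u y v : E}
    (hu : u ∈ A x) (hv : v ∈ A y) : 0 ≤ inner ℝ (u - v) (x - y) := (hA x u).mp hu y v hv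

/-- If `q - s x ∈ A x`, then `x` depends on `q` in a Lipschitz way. -/
theorem MaximallyMonotone.norm_sub_le {A : E → Set E} (hA : MaximallyMonotone A) {s : ℝ}
    {x x' q q' : E} (h : q - s • x ∈ A x) (h' : q' - s • x' ∈ A x') :
    s * ‖x - x'‖ ≤ ‖q - q'‖ := by
  have h1 := hA.inner_nonneg h h'
  rw [show q - s • x - (q' - s • x') = (q - q') - s • (x - x') by module, inner_sub_left,
    real_inner_smul_left, real_inner_self_eq_norm_sq] at h1
  have h2 := real_inner_le_norm (q - q') (x - x')
  rcases (norm_nonneg (x - x')).eq_or_lt with h0 | h0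
  · rw [← h0, mul_zero]
    exact norm_nonneg _
  · exact le_of_mul_le_mul_right (by nlinarith) h0

/-- A point monotonically related to the product of maximally monotone operators belongs to the
graph of each of them. -/
theorem mem_of_sum_inner_nonneg {ι : Type*} [Fintype ι] {A : ι → E → Set E}
    (hA : ∀ i, MaximallyMonotone (A i)) {a y : ι → E}
    (h : ∀ x' y' : ι → E, (∀ i, y' i ∈ A i (x' i)) →
      0 ≤ ∑ i, inner ℝ (y i - y' i) (a i - x' i)) (i : ι) : y i ∈ A i (a i) := by
  by_contra hi
  -- Test with the given pair itself in the coordinates already in the graph, and with a violating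
  -- pair in the others; the sum then becomes negative.
  have hex : ∀ l, ∃ p : E × E, p.2 ∈ A l p.1 ∧ inner ℝ (y l - p.2) (a l - p.1) ≤ 0 ∧
      (y l ∉ A l (a l) → inner ℝ (y l - p.2) (a l - p.1) < 0) := by
    intro l
    by_cases hl : y l ∈ A l (a l)
    · exact ⟨(a l, y l), hl, by simp, fun h => absurd hl h⟩
    · have h1 := hl
      rw [hA l] at h1
      push Not at h1
      obtain ⟨x', y', h2, h3⟩ := h1
      exact ⟨(x', y'), h2, h3.le, fun _ => h3⟩
  choose p hp1 hp2 hp3 using hex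
  have h1 := h (fun l => (p l).1) (fun l => (p l).2) hp1
  have h2 : ∑ l, inner ℝ (y l - (p l).2) (a l - (p l).1) < 0 := by
    rw [← Finset.sum_const_zero (s := Finset.univ (α := ι))]
    exact Finset.sum_lt_sum (fun l _ => hp2 l) ⟨i, Finset.mem_univ i, hp3 i hi⟩
  exact absurd h1 (not_le.mpr h2)

theorem Cocoercive.norm_sub_le {L : ℝ} (hL : 0 < L) {B : E → E} (hB : Cocoercive (1 / L) B)
    (x y : E) : ‖B x - B y‖ ≤ L * ‖x - y‖ := by
  have h1 := (hB x y).trans (real_inner_le_norm _ _)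
  rcases (norm_nonneg (B x - B y)).eq_or_lt with h0 | h0
  · rw [← h0]
    positivity
  · have h2 : 1 / L * ‖B x - B y‖ ≤ ‖x - y‖ := le_of_mul_le_mul_right (by nlinarith) h0
    calc ‖B x - B y‖ = L * (1 / L * ‖B x - B y‖) := by field_simp
      _ ≤ L * ‖x - y‖ := by gcongr

theorem Cocoercive.inner_nonneg {L : ℝ} (hL : 0 < L) {B : E → E} (hB : Cocoercive (1 / L) B)
    (x y : E) : 0 ≤ inner ℝ (B x - B y) (x - y) :=
  le_trans (by positivity) (hB x y)

theorem Cocoercive.maximallyMonotone {L : ℝ} (hL : 0 < L) {B : E → E}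
    (hB : Cocoercive (1 / L) B) : MaximallyMonotone (singleValued B) := by
  intro x u
  constructor
  · rintro rfl y v rfl
    exact hB.inner_nonneg hL x y
  · intro h
    set w := u - B x with hw
    -- Minty's trick with a fixed step: moving by `w / (2L)` changes `B` by at most `‖w‖ / 2`,
    -- whereas the hypothesis forces `‖w‖² ≤ ⟪change, w⟫`. Hence `w = 0`.
    have h1 := h (x + (2 * L)⁻¹ • w) _ rfl
    have h2 := hB.norm_sub_le hL (x + (2 * L)⁻¹ • w) x
    have h3 := real_inner_le_norm (B (x + (2 * L)⁻¹ • w) - B x) w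
    rw [show u - B (x + (2 * L)⁻¹ • w) = w - (B (x + (2 * L)⁻¹ • w) - B x) by rw [hw]; abel,
      show x - (x + (2 * L)⁻¹ • w) = -((2 * L)⁻¹ • w) by abel, inner_neg_right,
      real_inner_smul_right, inner_sub_left, real_inner_self_eq_norm_sq] at h1
    rw [add_sub_cancel_left, norm_smul, Real.norm_of_nonneg (by positivity), ← mul_assoc,
      show L * (2 * L)⁻¹ = 1 / 2 by field_simp] at h2
    have h4 : ‖w‖ ^ 2 - inner ℝ (B (x + (2 * L)⁻¹ • w) - B x) w ≤ 0 := by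
      by_contra! h5
      have : 0 < (2 * L)⁻¹ := by positivity
      nlinarith
    have h6 : ‖w‖ = 0 := by nlinarith [norm_nonneg w]
    exact sub_eq_zero.mp (norm_eq_zero.mp h6)

omit [InnerProductSpace ℝ E] in
theorem mem_resolvent_iff {A : E → Set E} {x y : E} : x ∈ resolvent A y ↔ y - x ∈ A x := by
  simp only [resolvent, Set.mem_ofPred_eq, Set.singleton_add, Set.image_add_left,
    Set.mem_preimage, neg_add_eq_sub]

theorem mem_smul_iff {A : E → Set E} {d : ℝ} (hd : d ≠ 0) {x y : E} :
    y ∈ (d • A) x ↔ d⁻¹ • y ∈ A x := by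
  rw [Pi.smul_apply, Set.mem_smul_set_iff_inv_smul_mem₀ hd]

omit [InnerProductSpace ℝ E] in
theorem mem_zer_iff {n m : ℕ} {F : Fin n → E → Set E} {B : Fin m → E → E} {a : E} :
    a ∈ zer (∑ i, F i + ∑ j, singleValued (B j)) ↔
      ∃ f : Fin n → E, (∀ i, f i ∈ F i a) ∧ ∑ i, f i + ∑ j, B j a = 0 := by
  simp only [zer, Set.mem_ofPred_eq, Pi.add_apply, Finset.sum_apply, Set.mem_add,
    Set.mem_fintype_sum, singleValued, Set.mem_singleton_iff]
  constructor
  · rintro ⟨_, ⟨f, hf, rfl⟩, _, ⟨b, hb, rfl⟩, h⟩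
    exact ⟨f, hf, by simpa [hb] using h⟩
  · rintro ⟨f, hf, h⟩
    exact ⟨_, ⟨f, hf, rfl⟩, _, ⟨fun j => B j a, fun _ => rfl, rfl⟩, h⟩

end Monotone

/-! ### Weak limits along a filter -/

section Weak

variable {E : Type*} [NormedAddCommGroup E] [InnerProductSpace ℝ E]

/-- `x` converges weakly to `a` along the filter `l`, tested with the inner product. -/
def WeakLim (l : Filter ℕ) (x : ℕ → E) (a : E) : Prop :=
  ∀ h : E, Tendsto (fun k => inner ℝ (x k) h) l (𝓝 (inner ℝ a h))

theorem weaklyConverges_iff [CompleteSpace E] {x : ℕ → E} {a : E} :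
    WeaklyConverges x a ↔ WeakLim atTop x a := by
  have hinj : Function.Injective (topDualPairing ℝ E).flip := by
    intro y y' h
    refine ext_inner_right ℝ fun w => ?_
    have := LinearMap.congr_fun h (InnerProductSpace.toDual ℝ E w)
    simpa [topDualPairing_apply, real_inner_comm] using this
  have key : WeaklyConverges x a ↔
      ∀ f : StrongDual ℝ E, Tendsto (fun k => f (x k)) atTop (𝓝 (f a)) :=
    WeakBilin.tendsto_iff_forall_eval_tendsto _ hinj
  rw [key]
  constructor
  · intro h w
    have := h (InnerProductSpace.toDual ℝ E w)
    simp only [InnerProductSpace.toDual_apply_apply, real_inner_comm _ w] at this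
    exact this
  · intro h f
    have := h ((InnerProductSpace.toDual ℝ E).symm f)
    simp only [real_inner_comm ((InnerProductSpace.toDual ℝ E).symm f),
      InnerProductSpace.toDual_symm_apply] at this
    exact this

theorem WeakLim.unique {l : Filter ℕ} [l.NeBot] {x : ℕ → E} {a b : E} (ha : WeakLim l x a)
    (hb : WeakLim l x b) : a = b :=
  ext_inner_right ℝ fun h => tendsto_nhds_unique (ha h) (hb h)

theorem WeakLim.add {l : Filter ℕ} {x y : ℕ → E} {a b : E} (ha : WeakLim l x a)
    (hb : WeakLim l y b) : WeakLim l (fun k => x k + y k) (a + b) := fun h => by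
  simpa only [inner_add_left] using (ha h).add (hb h)

theorem WeakLim.sub {l : Filter ℕ} {x y : ℕ → E} {a b : E} (ha : WeakLim l x a)
    (hb : WeakLim l y b) : WeakLim l (fun k => x k - y k) (a - b) := fun h => by
  simpa only [inner_sub_left] using (ha h).sub (hb h)

theorem weakLim_of_tendsto {l : Filter ℕ} {x : ℕ → E} {a : E} (h : Tendsto x l (𝓝 a)) :
    WeakLim l x a := fun _ => h.inner tendsto_const_nhds

theorem WeakLim.kron {H : Type*} [NormedAddCommGroup H] [InnerProductSpace ℝ H] {p q : ℕ}
    {l : Filter ℕ} {x : ℕ → HilbertPow H q} {a : HilbertPow H q} (h : WeakLim l x a)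
    (P : Matrix (Fin p) (Fin q) ℝ) :
    WeakLim l (fun k => DeviationFBS.kron P (x k)) (DeviationFBS.kron P a) := fun w => by
  simpa only [inner_kron] using h (DeviationFBS.kron Pᵀ w)

/-- Bounded sequences of a Hilbert space converge weakly along every ultrafilter. -/
theorem exists_weakLim_of_bounded [CompleteSpace E] (U : Ultrafilter ℕ) {x : ℕ → E} {r : ℝ}
    (hx : ∀ k, ‖x k‖ ≤ r) : ∃ a, WeakLim U x a := by
  let f : ℕ → WeakDual ℝ E := fun k => StrongDual.toWeakDual (InnerProductSpace.toDual ℝ E (x k))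
  have hf : ∀ k, f k ∈ WeakDual.toStrongDual ⁻¹' Metric.closedBall (0 : StrongDual ℝ E) r := by
    intro k
    simpa [f] using! hx k
  obtain ⟨g, -, hg⟩ := (WeakDual.isCompact_closedBall (𝕜 := ℝ) (0 : StrongDual ℝ E) r)
    |>.ultrafilter_le_nhds (U.map f)
      (le_principal_iff.mpr (Filter.mem_map.mpr (Filter.univ_mem' hf)))
  refine ⟨(InnerProductSpace.toDual ℝ E).symm (WeakDual.toStrongDual g), fun h => ?_⟩
  rw [InnerProductSpace.toDual_symm_apply]
  exact ((WeakDual.eval_continuous h).tendsto g).comp hg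

theorem tendsto_inner_zero_of_bounded {x w : ℕ → E} {r : ℝ} (hx : ∀ k, ‖x k‖ ≤ r)
    {l : Filter ℕ} (hw : Tendsto w l (𝓝 0)) : Tendsto (fun k => inner ℝ (x k) (w k)) l (𝓝 0) := by
  refine squeeze_zero_norm (a := fun k => r * ‖w k‖) (fun k => ?_) ?_
  · exact (norm_inner_le_norm _ _).trans (mul_le_mul_of_nonneg_right (hx k) (norm_nonneg _))
  · simpa using hw.norm.const_mul r

/-- Opial's lemma: if the distances of `z` to the points of `Z` converge and all weak cluster points
of `z` lie in `Z`, then `z` converges weakly to a point of `Z`. -/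
theorem exists_weakLim_of_fejer [CompleteSpace E] {Z : Set E} {z : ℕ → E} {r : ℝ}
    (hz : ∀ k, ‖z k‖ ≤ r) (hdist : ∀ p ∈ Z, ∃ l : ℝ, Tendsto (fun k => ‖z k - p‖) atTop (𝓝 l))
    (hclus : ∀ (U : Ultrafilter ℕ) (p : E), (U : Filter ℕ) ≤ atTop → WeakLim U z p → p ∈ Z) :
    ∃ p ∈ Z, WeakLim atTop z p := by
  obtain ⟨U, hU⟩ := Ultrafilter.exists_le (atTop : Filter ℕ)
  obtain ⟨p, hp⟩ := exists_weakLim_of_bounded U hz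
  refine ⟨p, hclus U p hU hp, fun h => (tendsto_iff_ultrafilter _ _ _).mpr fun V hV => ?_⟩
  obtain ⟨q, hq⟩ := exists_weakLim_of_bounded V hz
  suffices hpq : p = q by
    rw [hpq]
    exact hq h
  obtain ⟨a, ha⟩ := hdist p (hclus U p hU hp)
  obtain ⟨b, hb⟩ := hdist q (hclus V q hV hq)
  -- Polarization expresses this inner product through the two distances. Its limit is then both
  -- `⟪p, p - q⟫` and `⟪q, p - q⟫`.
  have hlim : ∃ c : ℝ, Tendsto (fun k => inner ℝ (z k) (p - q)) atTop (𝓝 c) := by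
    refine ⟨(b ^ 2 - a ^ 2 - ‖q‖ ^ 2 + ‖p‖ ^ 2) / 2, ?_⟩
    refine (((((hb.pow 2).sub (ha.pow 2)).sub_const (‖q‖ ^ 2)).add_const
      (‖p‖ ^ 2)).div_const 2).congr fun k => ?_
    rw [norm_sub_sq_real, norm_sub_sq_real, inner_sub_right]
    ring
  obtain ⟨c, hc⟩ := hlim
  have h1 := tendsto_nhds_unique (hp (p - q)) (hc.mono_left hU)
  have h2 := tendsto_nhds_unique (hq (p - q)) (hc.mono_left hV)
  rw [← sub_eq_zero, ← inner_self_eq_zero (𝕜 := ℝ), inner_sub_left, h1, h2, sub_self]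

end Weak

/-! ### The monotone inclusion behind the algorithm -/

section Inclusion

variable {H : Type*} [NormedAddCommGroup H] [InnerProductSpace ℝ H] {n m : ℕ}

/-- The matrix `N - D⁻¹`. -/
def lowerHalf (S : Matrix (Fin n) (Fin n) ℝ) : Matrix (Fin n) (Fin n) ℝ :=
  negLower S - (1 / 2 : ℝ) • Matrix.diagonal fun i => S i i

/-- This is where the choice `d_i = 2 / S i i` matters: quadratic forms of `N - D⁻¹` see only `-S /
2`. -/
theorem lowerHalf_add_transpose {S : Matrix (Fin n) (Fin n) ℝ} (hS : S.IsSymm) :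
    lowerHalf S + (lowerHalf S)ᵀ = -S := by
  ext i j
  have hij : S j i = S i j := hS.apply i j
  rcases lt_trichotomy i j with h | rfl | h
  · simp [lowerHalf, negLower, h, h.not_gt, h.ne, hij]
  · simp [lowerHalf, negLower]
    ring
  · simp [lowerHalf, negLower, h, h.not_gt, h.ne']

theorem inner_kron_lowerHalf {S : Matrix (Fin n) (Fin n) ℝ} (hS : S.IsSymm)
    (x : HilbertPow H n) : inner ℝ (kron (lowerHalf S) x) x = -(1 / 2) * inner ℝ x (kron S x) := by
  have h1 : inner ℝ x (kron (lowerHalf S + (lowerHalf S)ᵀ) x) = -inner ℝ x (kron S x) := by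
    rw [lowerHalf_add_transpose hS, ← neg_one_smul ℝ S, smul_kron, real_inner_smul_right]
    ring
  rw [add_kron, inner_add_right, ← inner_kron, real_inner_comm] at h1
  linarith

/-- The vector `(N - D⁻¹) x + M p - C B(b)`, whose `i`-th entry belongs to `F i (x i)` along the
algorithm. -/
def dualVec (B : Fin m → H → H) (M : Matrix (Fin n) (Fin (n - 1)) ℝ)
    (S : Matrix (Fin n) (Fin n) ℝ) (C : Matrix (Fin n) (Fin m) ℝ) (p : HilbertPow H (n - 1))
    (b : HilbertPow H m) (x : HilbertPow H n) : HilbertPow H n :=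
  kron (lowerHalf S) x + kron M p - kron C (prodMap B b)

/-- The pair `(p, a)` solves the primal-dual inclusion encoded by the fixed points of `opT`. -/
def IsSol (F : Fin n → H → Set H) (B : Fin m → H → H) (M : Matrix (Fin n) (Fin (n - 1)) ℝ)
    (S : Matrix (Fin n) (Fin n) ℝ) (C : Matrix (Fin n) (Fin m) ℝ) (p : HilbertPow H (n - 1))
    (a : H) : Prop :=
  ∀ i, dualVec B M S C p (diagVec m a) (diagVec n a) i ∈ F i a

variable {F : Fin n → H → Set H} {B : Fin m → H → H} {θ : ℝ} {Lc : Fin m → ℝ}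
  {M : Matrix (Fin n) (Fin (n - 1)) ℝ} {S : Matrix (Fin n) (Fin n) ℝ}
  {C : Matrix (Fin n) (Fin m) ℝ} {Q : Matrix (Fin m) (Fin n) ℝ}

theorem kron_negLower_apply (x : HilbertPow H n) (i : Fin n) :
    kron (negLower S) x i = -∑ j ∈ Finset.Iio i, S i j • x j := by
  rw [kron_apply, ← Finset.sum_neg_distrib,
    ← Finset.sum_subset (Finset.subset_univ (Finset.Iio i))]
  · refine Finset.sum_congr rfl fun j hj => ?_
    simp [negLower, Finset.mem_Iio.mp hj]
  · intro j _ hj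
    rw [Finset.mem_Iio] at hj
    simp [negLower, hj]

theorem kron_lowerHalf_apply (x : HilbertPow H n) (i : Fin n) :
    kron (lowerHalf S) x i = -∑ j ∈ Finset.Iio i, S i j • x j - (S i i / 2) • x i := by
  rw [lowerHalf, sub_kron, smul_kron, PiLp.sub_apply, PiLp.smul_apply, kron_negLower_apply]
  simp [Matrix.diagonal_apply, ite_smul, smul_smul, div_eq_inv_mul]

theorem stepSize_inv_smul (hS : ∀ i, 0 < S i i) (i : Fin n) (w x : H) :
    (stepSize S i)⁻¹ • (stepSize S i • w - x) = w - (S i i / 2) • x := by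
  have h := (hS i).ne'
  rw [smul_sub, smul_smul]
  congr 1
  · rw [stepSize, inv_mul_cancel₀ (by positivity), one_smul]
  · congr 1
    rw [stepSize, mul_inv, inv_inv]
    ring

theorem mem_resolvent_stepSize_iff (hS : ∀ i, 0 < S i i) {i : Fin n} {w x : H} :
    x ∈ resolvent (stepSize S i • F i) (stepSize S i • w) ↔ w - (S i i / 2) • x ∈ F i x := by
  have h : stepSize S i ≠ 0 := mul_ne_zero two_ne_zero (inv_ne_zero (hS i).ne')
  rw [mem_resolvent_iff, mem_smul_iff h, stepSize_inv_smul hS]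

/-- Causality: the forward terms used in row `i` only involve the first `i - 1` blocks. -/
theorem Causal.smul_partial_sum (h : Causal C Q) (x : HilbertPow H n) (u : H) (i : Fin n)
    (j : Fin m) (b : H → H) :
    C i j • b (∑ h ∈ Finset.Iio i, Q j h • x h + u) = C i j • b (kron Q x j + u) := by
  obtain ⟨A, hA, -, -, hC, hQ⟩ := h
  -- Either the coefficient `C i j` vanishes, or `j + 1 ≤ A i ≤ A l` for all `l ≥ i`, so that the
  -- omitted entries `Q j l` vanish.
  by_cases hj : (A i : ℕ) < j + 1
  · rw [hC i j hj, zero_smul, zero_smul]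
  · rw [kron_apply, Finset.sum_subset (Finset.subset_univ (Finset.Iio i))]
    intro l _ hl
    rw [Finset.mem_Iio, not_lt] at hl
    have h1 : (A i : ℕ) ≤ A l := hA hl
    rw [show Q j l = 0 from hQ l j (by omega), zero_smul]

theorem IsGenerated.dualVec_mem {γ ξ : ℕ → ℝ} {x : ℕ → HilbertPow H n}
    {z : ℕ → HilbertPow H (n - 1)} {u : ℕ → HilbertPow H m} {v : ℕ → HilbertPow H (n - 1)}
    (h : IsGenerated F B Lc M S C Q θ γ ξ x z u v) (hC : Causal C Q) (hS : ∀ i, 0 < S i i)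
    (k : ℕ) (i : Fin n) :
    dualVec B M S C (z k + v k) (kron Q (x k) + u k) (x k) i ∈ F i (x k i) := by
  have h1 := h.x_step k i
  rw [← smul_neg, ← smul_add, ← smul_sub, mem_resolvent_stepSize_iff hS] at h1
  convert h1 using 1
  simp only [dualVec, PiLp.sub_apply, PiLp.add_apply, kron_lowerHalf_apply, hC.smul_partial_sum]
  simp only [kron_apply, PiLp.add_apply, prodMap]
  abel

theorem IsGenerated.z_succ {γ ξ : ℕ → ℝ} {x : ℕ → HilbertPow H n}
    {z : ℕ → HilbertPow H (n - 1)} {u : ℕ → HilbertPow H m} {v : ℕ → HilbertPow H (n - 1)}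
    (h : IsGenerated F B Lc M S C Q θ γ ξ x z u v) (k : ℕ) :
    z (k + 1) = z k - γ k • kron Mᵀ (x k) := by
  ext i
  simpa using h.z_step k i

/-- The block version of `ker_le`: applying `Rᵀ` to `Mᵀ x = 0` shows that `x` equals the vector of
its mean. -/
theorem MatrixAssumption.exists_eq_diagVec (h : MatrixAssumption θ Lc M S C Q) (hn : 2 ≤ n)
    {x : HilbertPow H n} (hx : kron Mᵀ x = 0) : ∃ a, x = diagVec n a := by
  obtain ⟨R, hR⟩ := h.exists_right_inverse hn
  have h1 : kron ((M * R)ᵀ) x = 0 := by rw [Matrix.transpose_mul, mul_kron, hx, kron_zero]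
  rw [hR] at h1
  refine ⟨(n : ℝ)⁻¹ • ∑ i, x i, ?_⟩
  ext i
  have h2 := congrArg (fun w : HilbertPow H n => w i) h1
  rw [Matrix.transpose_sub, sub_kron, Matrix.transpose_one, one_kron, Matrix.transpose_smul,
    smul_kron] at h2
  simpa [sub_eq_zero] using h2

theorem mem_fixedPts_iff (h : MatrixAssumption θ Lc M S C Q) (hn : 2 ≤ n)
    (hS : ∀ i, 0 < S i i) {γ : ℝ} (hγ : 0 < γ) {p : HilbertPow H (n - 1)} :
    p ∈ fixedPts (opT F B M S C Q γ) ↔ ∃ a, IsSol F B M S C p a := by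
  have key : ∀ x : HilbertPow H n,
      x ∈ resolvent (prodSet fun i => stepSize S i • F i)
        (kron (Matrix.diagonal (stepSize S) * negLower S) x +
          kron (Matrix.diagonal (stepSize S) * M) p -
          kron (Matrix.diagonal (stepSize S) * C) (prodMap B (kron Q x))) ↔
      ∀ i, dualVec B M S C p (kron Q x) x i ∈ F i (x i) := by
    intro x
    rw [mem_resolvent_iff]
    refine forall_congr' fun i => ?_
    have hd : stepSize S i ≠ 0 := mul_ne_zero two_ne_zero (inv_ne_zero (hS i).ne')
    have hdiag : ∀ w : HilbertPow H n, kron (Matrix.diagonal (stepSize S)) w i =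
        stepSize S i • w i := fun w => by
      simp [Matrix.diagonal_apply, ite_smul]
    rw [mem_smul_iff hd, mul_kron, mul_kron, mul_kron, PiLp.sub_apply, PiLp.sub_apply,
      PiLp.add_apply, hdiag, hdiag, hdiag, ← smul_add, ← smul_sub, stepSize_inv_smul hS, dualVec,
      PiLp.sub_apply, PiLp.add_apply, kron_lowerHalf_apply, kron_negLower_apply]
    rw [show ∀ s t q r : H, s + q - r - t = s - t + q - r by intros; abel]
  constructor
  · rintro ⟨x, hx, hp⟩
    have h1 : kron Mᵀ x = 0 := by
      have : γ • kron Mᵀ x = 0 := by rwa [eq_comm, sub_eq_self] at hp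
      exact (smul_eq_zero.mp this).resolve_left hγ.ne'
    obtain ⟨a, rfl⟩ := h.exists_eq_diagVec hn h1
    refine ⟨a, ?_⟩
    have h2 := (key _).mp hx
    rwa [kron_diagVec h.Q_ones] at h2
  · rintro ⟨a, ha⟩
    refine ⟨diagVec n a, (key _).mpr ?_, ?_⟩
    · rwa [kron_diagVec h.Q_ones]
    · rw [kron_diagVec_eq_zero h.M_ones, smul_zero, sub_zero]

/-- Summing the rows removes `M` and, as the entries of `lowerHalf S` total `-eᵀ S e / 2 = 0`, the
diagonal part; each column of `C` has sum one. -/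
theorem MatrixAssumption.sum_dualVec (h : MatrixAssumption θ Lc M S C Q)
    (p : HilbertPow H (n - 1)) (b : HilbertPow H m) (a : H) :
    ∑ i, dualVec B M S C p b (diagVec n a) i + ∑ j, B j (b j) = 0 := by
  have h1 : ∑ i, kron (lowerHalf S) (diagVec n a) i = 0 := by
    have hsum := congrArg (fun P : Matrix (Fin n) (Fin n) ℝ => ∑ i, ∑ j, P i j)
      (lowerHalf_add_transpose h.S_symm)
    have hS0 : ∑ i, ∑ j, S i j = 0 := by
      simpa [dotProduct, Matrix.mulVec] using h.S_ones
    simp only [Matrix.add_apply, Matrix.transpose_apply, Finset.sum_add_distrib,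
      Matrix.neg_apply, Finset.sum_neg_distrib, hS0, neg_zero] at hsum
    rw [Finset.sum_comm (f := fun i j => lowerHalf S j i)] at hsum
    have h2 : ∑ i, ∑ j, lowerHalf S i j = 0 := by linarith
    simp only [kron_apply, diagVec_apply, ← Finset.sum_smul, h2, zero_smul]
  simp only [dualVec, PiLp.sub_apply, PiLp.add_apply, Finset.sum_sub_distrib,
    Finset.sum_add_distrib, h1, sum_kron (c := 0) h.M_ones, sum_kron h.C_ones]
  simp [prodMap]

theorem IsSol.mem_zer (h : MatrixAssumption θ Lc M S C Q) {p : HilbertPow H (n - 1)} {a : H}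
    (hp : IsSol F B M S C p a) : a ∈ zer (∑ i, F i + ∑ j, singleValued (B j)) :=
  mem_zer_iff.mpr ⟨_, hp, h.sum_dualVec p (diagVec m a) a⟩

theorem exists_isSol (h : MatrixAssumption θ Lc M S C Q) (hn : 2 ≤ n) {a : H}
    (ha : a ∈ zer (∑ i, F i + ∑ j, singleValued (B j))) : ∃ p, IsSol F B M S C p a := by
  obtain ⟨f, hf, hsum⟩ := mem_zer_iff.mp ha
  obtain ⟨R, hR⟩ := h.exists_right_inverse hn
  -- The part of `f` that `M p` has to supply. Its blocks sum to zero, so `p = R w` works.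
  set w : HilbertPow H n := WithLp.toLp 2 f - dualVec B M S C 0 (diagVec m a) (diagVec n a) with hw
  have hw0 : ∑ i, w i = 0 := by
    simp only [hw, PiLp.sub_apply, Finset.sum_sub_distrib]
    rw [sub_eq_zero]
    exact add_right_cancel (hsum.trans (h.sum_dualVec (B := B) 0 (diagVec m a) a).symm)
  have hMw : kron M (kron R w) = w := by
    rw [← mul_kron, hR, sub_kron, one_kron, smul_kron]
    ext i
    simp [hw0]
  refine ⟨kron R w, fun i => ?_⟩
  have : dualVec B M S C (kron R w) (diagVec m a) (diagVec n a) = WithLp.toLp 2 f := by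
    rw [dualVec, hMw, hw, dualVec, kron_zero]
    abel
  rw [this]
  exact hf i

end Inclusion

/-! ### The descent inequality -/

section Descent

variable {H : Type*} [NormedAddCommGroup H] [InnerProductSpace ℝ H] {n m : ℕ}
  {F : Fin n → H → Set H} {B : Fin m → H → H} {θ : ℝ} {Lc : Fin m → ℝ}
  {M : Matrix (Fin n) (Fin (n - 1)) ℝ} {S : Matrix (Fin n) (Fin n) ℝ}
  {C : Matrix (Fin n) (Fin m) ℝ} {Q : Matrix (Fin m) (Fin n) ℝ}

/-- Completing the square in `‖β‖` gives `L / 4 * ‖u - e‖²`; a second Young inequality with weight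
`θ` separates `u` from `e`. -/
theorem inner_young {E : Type*} [NormedAddCommGroup E] [InnerProductSpace ℝ E] {L θ : ℝ}
    (hL : 0 < L) (hθ : 0 < θ) (β e u : E) :
    inner ℝ β (u - e) - 1 / L * ‖β‖ ^ 2 ≤
      1 / 4 * (L * ((1 + 1 / θ) * ‖e‖ ^ 2 + (1 + θ) * ‖u‖ ^ 2)) := by
  have h1 := real_inner_le_norm β (u - e)
  have h2 : ‖u - e‖ ^ 2 ≤ (1 + 1 / θ) * ‖e‖ ^ 2 + (1 + θ) * ‖u‖ ^ 2 := by
    have h3 : ‖u - e‖ ^ 2 ≤ (‖u‖ + ‖e‖) ^ 2 := by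
      gcongr
      exact norm_sub_le u e
    have h4 : 0 ≤ (θ * ‖u‖ - ‖e‖) ^ 2 / θ := by positivity
    have h5 : (θ * ‖u‖ - ‖e‖) ^ 2 / θ = θ * ‖u‖ ^ 2 - 2 * (‖u‖ * ‖e‖) + 1 / θ * ‖e‖ ^ 2 := by
      field_simp
      ring
    nlinarith
  have h6 : ‖β‖ * ‖u - e‖ - 1 / L * ‖β‖ ^ 2 ≤ 1 / 4 * (L * ‖u - e‖ ^ 2) := by
    have h7 : 0 ≤ (‖β‖ - L / 2 * ‖u - e‖) ^ 2 / L := by positivity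
    have h8 : (‖β‖ - L / 2 * ‖u - e‖) ^ 2 / L =
        1 / L * ‖β‖ ^ 2 - ‖β‖ * ‖u - e‖ + 1 / 4 * (L * ‖u - e‖ ^ 2) := by
      field_simp
      ring
    linarith
  have h9 := mul_le_mul_of_nonneg_left h2 hL.le
  linarith

theorem MatrixAssumption.inner_kron_S_ge (h : MatrixAssumption θ Lc M S C Q)
    (x : HilbertPow H n) :
    ‖kron Mᵀ x‖ ^ 2 + 1 / 2 * (1 + 1 / θ) * weightedNormSq (Linv Lc) (kron (Cᵀ - Q) x) ≤
      inner ℝ x (kron S x) := by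
  have h1 := inner_kron_self_nonneg h.S_ge x
  rw [sub_kron, sub_kron, smul_kron, inner_sub_right, inner_sub_right, real_inner_smul_right,
    mul_kron, mul_kron, mul_kron, ← inner_kron (Cᵀ - Q), real_inner_comm (kron M _) x,
    inner_kron M, real_inner_self_eq_norm_sq] at h1
  rw [weightedNormSq]
  linarith

/-- The basic estimate: monotonicity of the `F i` and cocoercivity of the `B j` at one step. -/
theorem IsSol.norm_sq_le (h : MatrixAssumption θ Lc M S C Q) (hθ : 0 < θ)
    (hLc : ∀ j, 0 < Lc j) (hF : ∀ i, MaximallyMonotone (F i))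
    (hB : ∀ j, Cocoercive (1 / Lc j) (B j)) {p w : HilbertPow H (n - 1)} {a : H}
    (hp : IsSol F B M S C p a) {x : HilbertPow H n} {u : HilbertPow H m}
    (hx : ∀ i, dualVec B M S C w (kron Q x + u) x i ∈ F i (x i)) :
    ‖kron Mᵀ x‖ ^ 2 ≤
      2 * inner ℝ (w - p) (kron Mᵀ x) + (1 + θ) / 2 * weightedNormSq (Linv Lc) u := by
  set δ := x - diagVec n a with hδ
  set β := prodMap B (kron Q x + u) - prodMap B (diagVec m a) with hβ
  have hMδ : kron Mᵀ δ = kron Mᵀ x := by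
    rw [hδ, kron_sub, kron_diagVec_eq_zero h.M_ones, sub_zero]
  have hmono : 0 ≤ inner ℝ (dualVec B M S C w (kron Q x + u) x -
      dualVec B M S C p (diagVec m a) (diagVec n a)) δ := by
    rw [PiLp.inner_apply]
    exact Finset.sum_nonneg fun i _ => (hF i).inner_nonneg (hx i) (hp i)
  have hdiff : dualVec B M S C w (kron Q x + u) x -
      dualVec B M S C p (diagVec m a) (diagVec n a) =
      kron (lowerHalf S) δ + kron M (w - p) - kron C β := by
    rw [hδ, hβ, kron_sub, kron_sub, kron_sub, dualVec, dualVec]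
    abel
  rw [hdiff, inner_sub_left, inner_add_left, inner_kron_lowerHalf h.S_symm, inner_kron M, hMδ,
    inner_kron C] at hmono
  have hS := h.inner_kron_S_ge δ
  rw [hMδ] at hS
  have hcoco : -inner ℝ β (kron Cᵀ δ) ≤
      1 / 4 * ((1 + 1 / θ) * weightedNormSq (Linv Lc) (kron (Cᵀ - Q) δ) +
        (1 + θ) * weightedNormSq (Linv Lc) u) := by
    rw [weightedNormSq_Linv, weightedNormSq_Linv, PiLp.inner_apply, ← Finset.sum_neg_distrib,
      Finset.mul_sum, Finset.mul_sum, ← Finset.sum_add_distrib, Finset.mul_sum]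
    refine Finset.sum_le_sum fun j _ => ?_
    have h1 := hB j (kron Q x j + u j) a
    have h2 := inner_young (hLc j) hθ (β j) (kron (Cᵀ - Q) δ j) (u j)
    -- Cocoercivity is measured at `Q x + u`, but `B` enters the inclusion through `C`. After
    -- halving the bound on `S`, the mismatch `(Cᵀ - Q) δ` cancels exactly.
    have h3 : kron Q x j + u j - a = kron Cᵀ δ j + (u j - kron (Cᵀ - Q) δ j) := by
      rw [sub_kron, PiLp.sub_apply, hδ, kron_sub Q, kron_diagVec h.Q_ones, PiLp.sub_apply,
        diagVec_apply]
      abel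
    have h4 : B j (kron Q x j + u j) - B j a = β j := rfl
    rw [h3, h4, inner_add_right] at h1
    linarith
  linarith

/-- One step of the algorithm, measured at a solution. -/
theorem norm_sub_sq_le_of_step {E : Type*} [NormedAddCommGroup E] [InnerProductSpace ℝ E]
    {γ c : ℝ} (hγ0 : 0 < γ) (hγ1 : γ < 1) {z z' v p g : E} (hz : z' = z - γ • g)
    (hg : ‖g‖ ^ 2 ≤ 2 * inner ℝ (z + v - p) g + c) :
    ‖z' - p‖ ^ 2 ≤ ‖z - p‖ ^ 2 - (1 - γ) / γ * ‖z' - z + (γ / (1 - γ)) • v‖ ^ 2 +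
      (γ / (1 - γ) * ‖v‖ ^ 2 + γ * c) := by
  have h1 : 0 < 1 - γ := by linarith
  have h2 : z' - p = (z - p) - γ • g := by rw [hz]; abel
  have h3 : z' - z + (γ / (1 - γ)) • v = (γ / (1 - γ)) • v - γ • g := by rw [hz]; abel
  rw [h2, h3, norm_sub_sq_real (z - p), norm_sub_sq_real _ (γ • g), norm_smul, norm_smul,
    Real.norm_of_nonneg hγ0.le, Real.norm_of_nonneg (by positivity), real_inner_smul_right,
    real_inner_smul_right, real_inner_smul_left]
  rw [show z + v - p = (z - p) + v by abel, inner_add_left] at hg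
  -- The weights complete the square in `v`; the remaining `γ (1 - γ) ‖g‖²` and the `γ² ‖g‖²` of the
  -- step add up to the `γ ‖g‖²` controlled by `hg`.
  have h4 : (1 - γ) / γ * ((γ / (1 - γ) * ‖v‖) ^ 2 -
      2 * (γ * (γ / (1 - γ) * inner ℝ v g)) + (γ * ‖g‖) ^ 2) =
      γ / (1 - γ) * ‖v‖ ^ 2 - 2 * γ * inner ℝ v g + γ * (1 - γ) * ‖g‖ ^ 2 := by
    field_simp
  have h5 := mul_le_mul_of_nonneg_left hg hγ0.le
  rw [h4]
  linarith

/-- The Lyapunov argument for sequences of real numbers. -/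
theorem summable_and_tendsto_of_lyapunov {ε : ℝ} (hε : 0 < ε) {a e l ξ : ℕ → ℝ}
    (ha : ∀ k, 0 ≤ a k) (he : ∀ k, 0 ≤ e k) (hl : ∀ k, 0 ≤ l k) (hξ : ∀ k, ξ k ≤ 1 - ε)
    (hstep : ∀ k, a (k + 1) ≤ a k - l k + e k) (hdev : ∀ k, e (k + 1) ≤ ξ k * l k) :
    Summable l ∧ Tendsto e atTop (𝓝 0) ∧ ∃ c, Tendsto a atTop (𝓝 c) := by
  -- The next deviation costs at most `(1 - ε) l k` of the gain `l k`, so `a + e` still decreases by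
  -- `ε l k`.
  have hV : ∀ k, ε * l k ≤ (a k + e k) - (a (k + 1) + e (k + 1)) := fun k => by
    have := mul_le_mul_of_nonneg_right (hξ k) (hl k)
    linarith [hstep k, hdev k]
  have hsum : Summable l := by
    have h1 : Summable fun k => ε * l k := by
      refine summable_of_sum_range_le (c := a 0 + e 0) (fun k => mul_nonneg hε.le (hl k))
        fun N => ?_
      refine (Finset.sum_le_sum fun k _ => hV k).trans ?_
      rw [Finset.sum_range_sub' (fun k => a k + e k)]
      linarith [ha N, he N]
    exact (summable_mul_left_iff hε.ne').mp h1
  have he0 : Tendsto e atTop (𝓝 0) := by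
    rw [← tendsto_add_atTop_iff_nat 1]
    refine squeeze_zero (fun k => he (k + 1)) (fun k => ?_) hsum.tendsto_atTop_zero
    have := mul_le_mul_of_nonneg_right (hξ k) (hl k)
    nlinarith [hdev k, hl k]
  refine ⟨hsum, he0, ?_⟩
  have hanti : Antitone fun k => a k + e k := antitone_nat_of_succ_le fun k => by
    have := mul_nonneg hε.le (hl k)
    linarith [hV k]
  have hbdd : BddBelow (Set.range fun k => a k + e k) :=
    ⟨0, by rintro _ ⟨k, rfl⟩; exact add_nonneg (ha k) (he k)⟩
  exact ⟨_, by simpa using (tendsto_atTop_ciInf hanti hbdd).sub he0⟩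

end Descent

/-! ### Boundedness and weak cluster points -/

section Cluster

variable {H : Type*} [NormedAddCommGroup H] [InnerProductSpace ℝ H] {n m : ℕ}
  {F : Fin n → H → Set H} {B : Fin m → H → H} {θ : ℝ} {Lc : Fin m → ℝ}
  {M : Matrix (Fin n) (Fin (n - 1)) ℝ} {S : Matrix (Fin n) (Fin n) ℝ}
  {C : Matrix (Fin n) (Fin m) ℝ} {Q : Matrix (Fin m) (Fin n) ℝ}

omit [InnerProductSpace ℝ H] in
theorem norm_le_of_forall_apply_le {p : ℕ} {x : HilbertPow H p} {r : ℝ}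
    (hx : ∀ i, ‖x i‖ ≤ r) : ‖x‖ ≤ √(p * r ^ 2) := by
  refine Real.le_sqrt_of_sq_le ?_
  rw [PiLp.norm_sq_eq_of_L2]
  refine (Finset.sum_le_sum fun i _ => pow_le_pow_left₀ (norm_nonneg _) (hx i) 2).trans ?_
  simp

theorem exists_norm_le_of_tendsto {E : Type*} [NormedAddCommGroup E] {x : ℕ → E} {a : E}
    (h : Tendsto x atTop (𝓝 a)) : ∃ r, ∀ k, ‖x k‖ ≤ r := by
  obtain ⟨r, hr⟩ := h.norm.bddAbove_range
  exact ⟨r, fun k => hr ⟨k, rfl⟩⟩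

/-- If `M* x` tends to `0`, then so does every combination of the blocks of `x` whose coefficients
sum to zero. -/
theorem MatrixAssumption.tendsto_kron_zero (h : MatrixAssumption θ Lc M S C Q) (hn : 2 ≤ n)
    {x : ℕ → HilbertPow H n} (hx : Tendsto (fun k => kron Mᵀ (x k)) atTop (𝓝 0)) {q : ℕ}
    {P : Matrix (Fin q) (Fin n) ℝ} (hP : P *ᵥ (fun _ => 1) = 0) :
    Tendsto (fun k => kron P (x k)) atTop (𝓝 0) := by
  obtain ⟨R, hR⟩ := h.exists_right_inverse hn
  -- `(M R)ᵀ` differs from the identity by a multiple of the all-ones matrix, which `P` annihilates.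
  have hPR : P = P * Rᵀ * Mᵀ := by
    rw [Matrix.mul_assoc, ← Matrix.transpose_mul, hR, Matrix.transpose_sub, Matrix.transpose_one,
      Matrix.mul_sub, Matrix.mul_one, eq_comm, sub_eq_self]
    ext i j
    have := congrFun hP i
    simp only [Matrix.mulVec, dotProduct, mul_one, Pi.zero_apply] at this
    simp [Matrix.mul_apply, ← Finset.sum_mul, this]
  have h1 := ((continuous_kron (H := H) (P * Rᵀ)).tendsto 0).comp hx
  rw [kron_zero] at h1
  refine h1.congr fun k => ?_
  conv_rhs => rw [hPR]
  rw [mul_kron _ Mᵀ, Function.comp]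

/-- The first row has no preceding blocks and, because `A` starts at `0`, no forward terms. It ties
the first block of `x` to `M w` alone, which gives both boundedness and uniqueness of the primal
point. -/
theorem Causal.dualVec_first (h : Causal C Q) {i : Fin n} (hi : (i : ℕ) = 0)
    (w : HilbertPow H (n - 1)) (b : HilbertPow H m) (x : HilbertPow H n) :
    dualVec B M S C w b x i = kron M w i - (S i i / 2) • x i := by
  obtain ⟨A, -, hA, -, hC, -⟩ := h
  have h1 : kron C (prodMap B b) i = 0 := by
    rw [kron_apply]
    exact Finset.sum_eq_zero fun j _ => by rw [hC i j (by simp [hA i hi]), zero_smul]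
  have h2 : Finset.Iio i = ∅ := by
    ext j
    simp [Fin.lt_def, hi]
  rw [dualVec, PiLp.sub_apply, PiLp.add_apply, h1, kron_lowerHalf_apply, h2]
  simp only [Finset.sum_empty, neg_zero]
  abel

theorem IsSol.unique (hC : Causal C Q) (hn : 2 ≤ n) (hS : ∀ i, 0 < S i i)
    (hF : ∀ i, MaximallyMonotone (F i)) {p : HilbertPow H (n - 1)} {a a' : H}
    (h : IsSol F B M S C p a) (h' : IsSol F B M S C p a') : a = a' := by
  have h1 := h ⟨0, by omega⟩
  have h2 := h' ⟨0, by omega⟩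
  rw [hC.dualVec_first rfl, diagVec_apply] at h1 h2
  have h3 := (hF _).norm_sub_le h1 h2
  rw [sub_self, norm_zero] at h3
  have h4 := hS ⟨0, by omega⟩
  have h5 : ‖a - a'‖ ≤ 0 := le_of_mul_le_mul_left (by rwa [mul_zero]) (half_pos h4)
  exact sub_eq_zero.mp (norm_le_zero_iff.mp h5)

theorem exists_norm_le_of_dualVec_mem (h : MatrixAssumption θ Lc M S C Q) (hn : 2 ≤ n)
    (hS : ∀ i, 0 < S i i) (hF : ∀ i, MaximallyMonotone (F i)) {p : HilbertPow H (n - 1)} {a : H}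
    (hp : IsSol F B M S C p a) {w : ℕ → HilbertPow H (n - 1)} {r : ℝ} (hw : ∀ k, ‖w k‖ ≤ r)
    {b : ℕ → HilbertPow H m} {x : ℕ → HilbertPow H n}
    (hx : Tendsto (fun k => kron Mᵀ (x k)) atTop (𝓝 0))
    (hmem : ∀ k i, dualVec B M S C (w k) (b k) (x k) i ∈ F i (x k i)) :
    ∃ r', ∀ k, ‖x k‖ ≤ r' := by
  set i₀ : Fin n := ⟨0, by omega⟩ with hi₀
  have hs := half_pos (hS i₀)
  have h0 : ∀ k, ‖x k i₀‖ ≤ (S i₀ i₀ / 2)⁻¹ * (‖kronCLM (H := H) M‖ * (r + ‖p‖)) + ‖a‖ := by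
    intro k
    have h1 := hmem k i₀
    have h2 := hp i₀
    rw [h.causal.dualVec_first rfl] at h1 h2
    have h3 := (hF _).norm_sub_le h1 h2
    rw [← PiLp.sub_apply, ← kron_sub] at h3
    have h4 : ‖kron M (w k - p) i₀‖ ≤ ‖kronCLM (H := H) M‖ * (r + ‖p‖) :=
      calc ‖kron M (w k - p) i₀‖ ≤ ‖kron M (w k - p)‖ := PiLp.norm_apply_le _ _
        _ ≤ ‖kronCLM (H := H) M‖ * ‖w k - p‖ := (kronCLM (H := H) M).le_opNorm _
        _ ≤ ‖kronCLM (H := H) M‖ * (r + ‖p‖) := by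
          gcongr
          exact (norm_sub_le _ _).trans (by gcongr; exact hw k)
    have h5 : ‖x k i₀ - a‖ ≤ (S i₀ i₀ / 2)⁻¹ * (‖kronCLM (H := H) M‖ * (r + ‖p‖)) := by
      rw [inv_mul_eq_div, le_div_iff₀ hs, mul_comm]
      exact h3.trans h4
    linarith [norm_le_insert' (x k i₀) a]
  -- `P` subtracts the first block from every block; these differences tend to zero, so the bound on
  -- the first block carries over.
  set P : Matrix (Fin n) (Fin n) ℝ := 1 - Matrix.of fun _ j => if j = i₀ then 1 else 0 with hP
  have hP1 : P *ᵥ (fun _ => 1) = 0 := by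
    ext i
    simp [hP, Matrix.mulVec, dotProduct, Matrix.one_apply]
  obtain ⟨r₁, hr₁⟩ := exists_norm_le_of_tendsto (h.tendsto_kron_zero hn hx hP1)
  refine ⟨_, fun k => norm_le_of_forall_apply_le (r := r₁ +
    ((S i₀ i₀ / 2)⁻¹ * (‖kronCLM (H := H) M‖ * (r + ‖p‖)) + ‖a‖)) fun i => ?_⟩
  have h6 : x k i = kron P (x k) i + x k i₀ := by
    rw [hP, sub_kron, one_kron, PiLp.sub_apply]
    simp [ite_smul]
  rw [h6]
  exact (norm_add_le _ _).trans
    (add_le_add ((PiLp.norm_apply_le _ _).trans (hr₁ k)) (h0 k))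

/-- The left side pairs sequences that converge only weakly. On the right, `S x`, `Mᵀ x` and `b - Cᵀ
x` tend strongly to zero along the algorithm, so the limit can be taken. -/
theorem MatrixAssumption.inner_dual_identity (h : MatrixAssumption θ Lc M S C Q)
    (w : HilbertPow H (n - 1)) (x : HilbertPow H n) (β b : HilbertPow H m) :
    inner ℝ (kron (lowerHalf S) x + kron M w - kron C β) x + inner ℝ β b =
      -(1 / 2) * inner ℝ x (kron S x) + inner ℝ w (kron Mᵀ x) + inner ℝ β (b - kron Cᵀ x) := by
  rw [inner_sub_left, inner_add_left, inner_kron_lowerHalf h.S_symm, inner_kron M, inner_kron C,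
    inner_sub_right]
  ring

/-- Weak cluster points of the iterates are solutions. -/
theorem exists_isSol_of_weakLim [CompleteSpace H] (h : MatrixAssumption θ Lc M S C Q)
    (hn : 2 ≤ n) (hF : ∀ i, MaximallyMonotone (F i)) (hLc : ∀ j, 0 < Lc j)
    (hB : ∀ j, Cocoercive (1 / Lc j) (B j)) {w : ℕ → HilbertPow H (n - 1)} {r r' : ℝ}
    (hw : ∀ k, ‖w k‖ ≤ r) {u : ℕ → HilbertPow H m} (hu : Tendsto u atTop (𝓝 0))
    {x : ℕ → HilbertPow H n} (hxb : ∀ k, ‖x k‖ ≤ r')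
    (hx : Tendsto (fun k => kron Mᵀ (x k)) atTop (𝓝 0))
    (hmem : ∀ k i, dualVec B M S C (w k) (kron Q (x k) + u k) (x k) i ∈ F i (x k i))
    {U : Ultrafilter ℕ} (hU : (U : Filter ℕ) ≤ atTop) {p : HilbertPow H (n - 1)}
    (hp : WeakLim U w p) : ∃ a, IsSol F B M S C p a ∧ WeakLim U x (diagVec n a) := by
  obtain ⟨x', hx'⟩ := exists_weakLim_of_bounded U hxb
  have hMx' : kron Mᵀ x' = 0 :=
    (hx'.kron Mᵀ).unique (weakLim_of_tendsto (hx.mono_left hU))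
  obtain ⟨a, rfl⟩ := h.exists_eq_diagVec hn hMx'
  set b : ℕ → HilbertPow H m := fun k => kron Q (x k) + u k with hb
  set β : ℕ → HilbertPow H m := fun k => prodMap B (b k) with hβ
  have hblim : WeakLim U b (diagVec m a) := by
    have := (hx'.kron Q).add (weakLim_of_tendsto (hu.mono_left hU))
    rwa [kron_diagVec h.Q_ones, add_zero] at this
  obtain ⟨ru, hru⟩ := exists_norm_le_of_tendsto hu
  have hβb : ∃ rβ, ∀ k, ‖β k‖ ≤ rβ := by
    refine ⟨_, fun k => norm_le_of_forall_apply_le (r := ∑ j, (‖B j 0‖ +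
      Lc j * (‖kronCLM (H := H) Q‖ * r' + ru))) fun j => ?_⟩
    have hr' : 0 ≤ r' := (norm_nonneg _).trans (hxb k)
    have hru0 : 0 ≤ ru := (norm_nonneg _).trans (hru k)
    have h1 : ‖b k j‖ ≤ ‖kronCLM (H := H) Q‖ * r' + ru := by
      refine (PiLp.norm_apply_le _ _).trans ((norm_add_le _ _).trans (add_le_add ?_ (hru k)))
      exact ((kronCLM (H := H) Q).le_opNorm _).trans (by gcongr; exact hxb k)
    have h2 : ‖β k j‖ ≤ ‖B j 0‖ + Lc j * (‖kronCLM (H := H) Q‖ * r' + ru) := by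
      have h3 := (hB j).norm_sub_le (hLc j) (b k j) 0
      rw [sub_zero] at h3
      have h4 := norm_le_insert' (B j (b k j)) (B j 0)
      have h5 := mul_le_mul_of_nonneg_left h1 (hLc j).le
      change ‖B j (b k j)‖ ≤ _
      linarith
    refine h2.trans (Finset.single_le_sum (f := fun j => ‖B j 0‖ +
      Lc j * (‖kronCLM (H := H) Q‖ * r' + ru)) (fun l _ => ?_) (Finset.mem_univ j))
    have := (hLc l).le
    positivity
  obtain ⟨rβ, hrβ⟩ := hβb
  obtain ⟨β', hβ'⟩ := exists_weakLim_of_bounded U hrβ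
  set y : ℕ → HilbertPow H n := fun k => dualVec B M S C (w k) (b k) (x k) with hy
  set y' : HilbertPow H n := kron (lowerHalf S) (diagVec n a) + kron M p - kron C β' with hy'
  have hylim : WeakLim U y y' :=
    ((hx'.kron (lowerHalf S)).add (hp.kron M)).sub (hβ'.kron C)
  have hlim : Tendsto (fun k => inner ℝ (y k) (x k) + inner ℝ (β k) (b k)) U
      (𝓝 (inner ℝ y' (diagVec n a) + inner ℝ β' (diagVec m a))) := by
    have h1 : inner ℝ y' (diagVec n a) + inner ℝ β' (diagVec m a) = 0 := by
      rw [hy', h.inner_dual_identity, kron_diagVec_eq_zero h.S_mulVec_ones,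
        kron_diagVec_eq_zero h.M_ones, kron_diagVec h.C_ones]
      simp
    have h2 : Tendsto (fun k => b k - kron Cᵀ (x k)) atTop (𝓝 0) := by
      have := hu.sub (h.tendsto_kron_zero hn hx h.sub_ones)
      rw [sub_zero] at this
      refine this.congr fun k => ?_
      simp only [hb, sub_kron]
      abel
    have h3 := ((tendsto_inner_zero_of_bounded hxb
      (h.tendsto_kron_zero hn hx h.S_mulVec_ones)).const_mul (-(1 / 2))).add
      (tendsto_inner_zero_of_bounded hw hx) |>.add (tendsto_inner_zero_of_bounded hrβ h2)
    rw [mul_zero, add_zero, add_zero] at h3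
    rw [h1]
    refine (h3.mono_left hU).congr fun k => ?_
    rw [← h.inner_dual_identity]
    rfl
  -- The weak limit `β'` is not yet known to be `B(a)`, so the `B j` join the `F i` as further
  -- maximally monotone operators, and `β' = B(a)` is obtained together with the inclusions.
  have hgraph := mem_of_sum_inner_nonneg
    (A := Sum.elim F fun j => singleValued (B j)) (a := fun _ => a) (y := Sum.elim y' β')
    (by
      rintro (i | j)
      · exact hF i
      · exact (hB j).maximallyMonotone (hLc j))
    (by
      intro s t hst
      rw [Fintype.sum_sum_type]
      set s₁ : HilbertPow H n := WithLp.toLp 2 fun i => s (Sum.inl i) with hs₁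
      set t₁ : HilbertPow H n := WithLp.toLp 2 fun i => t (Sum.inl i) with ht₁
      set s₂ : HilbertPow H m := WithLp.toLp 2 fun j => s (Sum.inr j) with hs₂
      set t₂ : HilbertPow H m := WithLp.toLp 2 fun j => t (Sum.inr j) with ht₂
      have hgoal : 0 ≤ inner ℝ (y' - t₁) (diagVec n a - s₁) +
          inner ℝ (β' - t₂) (diagVec m a - s₂) := by
        have h1 : Tendsto (fun k => inner ℝ (y k - t₁) (x k - s₁) +
            inner ℝ (β k - t₂) (b k - s₂)) U (𝓝 (inner ℝ (y' - t₁) (diagVec n a - s₁) +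
              inner ℝ (β' - t₂) (diagVec m a - s₂))) := by
          -- After expansion, the products of two varying sequences occur only in the combination
          -- handled by `hlim`; the other terms need weak convergence only.
          have h2 := (((((hlim.sub (hylim s₁)).sub (hx' t₁)).sub (hβ' s₂)).sub
            (hblim t₂)).add_const (inner ℝ t₁ s₁ + inner ℝ t₂ s₂))
          refine (h2.congr fun k => ?_).trans_eq ?_
          · simp only [inner_sub_left, inner_sub_right, real_inner_comm t₁, real_inner_comm t₂]
            ring
          · simp only [inner_sub_left, inner_sub_right, real_inner_comm t₁, real_inner_comm t₂]
            congr 1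
            ring
        refine ge_of_tendsto' h1 fun k => add_nonneg ?_ ?_
        · rw [PiLp.inner_apply]
          exact Finset.sum_nonneg fun i _ => (hF i).inner_nonneg (hmem k i) (hst (Sum.inl i))
        · rw [PiLp.inner_apply]
          refine Finset.sum_nonneg fun j _ => ?_
          have h3 : t (Sum.inr j) = B j (s (Sum.inr j)) := hst (Sum.inr j)
          have h4 := (hB j).inner_nonneg (hLc j) (b k j) (s (Sum.inr j))
          rw [← h3] at h4
          exact h4
      rw [PiLp.inner_apply, PiLp.inner_apply] at hgoal
      exact hgoal)
  have hβa : β' = prodMap B (diagVec m a) := by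
    ext j
    exact hgraph (Sum.inr j)
  refine ⟨a, fun i => ?_, hx'⟩
  have := hgraph (Sum.inl i)
  rw [Sum.elim_inl, Sum.elim_inl, hy', hβa] at this
  exact this

end Cluster

/-! ### Convergence of the algorithm -/

section Convergence

variable {H : Type*} [NormedAddCommGroup H] [InnerProductSpace ℝ H] {n m : ℕ}
  {F : Fin n → H → Set H} {B : Fin m → H → H} {ε θ : ℝ} {γ ξ : ℕ → ℝ} {Lc : Fin m → ℝ}
  {M : Matrix (Fin n) (Fin (n - 1)) ℝ} {S : Matrix (Fin n) (Fin n) ℝ}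
  {C : Matrix (Fin n) (Fin m) ℝ} {Q : Matrix (Fin m) (Fin n) ℝ}
  {x : ℕ → HilbertPow H n} {z : ℕ → HilbertPow H (n - 1)}
  {u : ℕ → HilbertPow H m} {v : ℕ → HilbertPow H (n - 1)}

theorem ParameterAssumption.gamma_pos (h : ParameterAssumption ε θ γ ξ) (k : ℕ) : 0 < γ k :=
  h.eps_pos.trans_le (h.gamma_mem k).1

theorem ParameterAssumption.eps_le (h : ParameterAssumption ε θ γ ξ) (k : ℕ) : ε ≤ 1 - γ k := by
  linarith [(h.gamma_mem k).2]

theorem ParameterAssumption.gamma_lt_one (h : ParameterAssumption ε θ γ ξ) (k : ℕ) : γ k < 1 := by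
  linarith [h.eps_le k, h.eps_pos]

/-- The size of the deviations, in the norm of the safeguarding condition. -/
def deviationSq (θ : ℝ) (Lc : Fin m → ℝ) (γ : ℕ → ℝ) (u : ℕ → HilbertPow H m)
    (v : ℕ → HilbertPow H (n - 1)) (k : ℕ) : ℝ :=
  γ k / (1 - γ k) * ‖v k‖ ^ 2 + γ k * (1 + θ) / 2 * weightedNormSq (Linv Lc) (u k)

theorem weightedNormSq_Linv_nonneg (hLc : ∀ j, 0 < Lc j) (w : HilbertPow H m) :
    0 ≤ weightedNormSq (Linv Lc) w := by
  rw [weightedNormSq_Linv]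
  exact Finset.sum_nonneg fun j _ => mul_nonneg (hLc j).le (sq_nonneg _)

theorem ParameterAssumption.lSq_nonneg (h : ParameterAssumption ε θ γ ξ) (k : ℕ) :
    0 ≤ lSq γ z v k := by
  have h1 := h.gamma_pos k
  have h2 := h.gamma_lt_one k
  exact mul_nonneg (div_nonneg (by linarith) h1.le) (sq_nonneg _)

theorem ParameterAssumption.norm_v_sq_le (h : ParameterAssumption ε θ γ ξ) (hLc : ∀ j, 0 < Lc j)
    (k : ℕ) : ε * ‖v k‖ ^ 2 ≤ deviationSq θ Lc γ u v k := by
  have h1 := h.gamma_pos k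
  have h2 := h.gamma_lt_one k
  have h3 : ε ≤ γ k / (1 - γ k) := by
    rw [le_div_iff₀ (by linarith)]
    nlinarith [(h.gamma_mem k).1, h.eps_pos]
  have h4 := weightedNormSq_Linv_nonneg hLc (u k)
  have h5 : 0 ≤ γ k * (1 + θ) / 2 := by
    have := h.theta_pos
    positivity
  exact (mul_le_mul_of_nonneg_right h3 (sq_nonneg _)).trans
    (le_add_of_nonneg_right (mul_nonneg h5 h4))

theorem ParameterAssumption.norm_u_sq_le (h : ParameterAssumption ε θ γ ξ) (hLc : ∀ j, 0 < Lc j)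
    (k : ℕ) (j : Fin m) : ε / 2 * Lc j * ‖u k j‖ ^ 2 ≤ deviationSq θ Lc γ u v k := by
  have h1 := h.gamma_pos k
  have h2 := h.gamma_lt_one k
  have h3 : Lc j * ‖u k j‖ ^ 2 ≤ weightedNormSq (Linv Lc) (u k) := by
    rw [weightedNormSq_Linv]
    exact Finset.single_le_sum (f := fun j => Lc j * ‖u k j‖ ^ 2)
      (fun l _ => mul_nonneg (hLc l).le (sq_nonneg _)) (Finset.mem_univ j)
  have h4 : ε / 2 ≤ γ k * (1 + θ) / 2 := by
    nlinarith [(h.gamma_mem k).1, mul_pos h1 h.theta_pos]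
  have h5 : 0 ≤ γ k / (1 - γ k) * ‖v k‖ ^ 2 :=
    mul_nonneg (div_nonneg h1.le (by linarith)) (sq_nonneg _)
  have h6 := mul_le_mul h4 h3 (mul_nonneg (hLc j).le (sq_nonneg _))
    ((half_pos h.eps_pos).le.trans h4)
  rw [mul_assoc]
  exact h6.trans (le_add_of_nonneg_left h5)

theorem ParameterAssumption.tendsto_v (h : ParameterAssumption ε θ γ ξ) (hLc : ∀ j, 0 < Lc j)
    (hdev : Tendsto (deviationSq θ Lc γ u v) atTop (𝓝 0)) : Tendsto v atTop (𝓝 0) := by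
  rw [tendsto_zero_iff_norm_tendsto_zero]
  have h1 : Tendsto (fun k => ‖v k‖ ^ 2) atTop (𝓝 0) := by
    refine squeeze_zero (fun k => sq_nonneg _) (fun k => ?_)
      (by simpa using hdev.const_mul ε⁻¹)
    rw [← div_eq_inv_mul, le_div_iff₀ h.eps_pos, mul_comm]
    exact h.norm_v_sq_le hLc k
  simpa using h1.sqrt

theorem ParameterAssumption.tendsto_u (h : ParameterAssumption ε θ γ ξ) (hLc : ∀ j, 0 < Lc j)
    (hdev : Tendsto (deviationSq θ Lc γ u v) atTop (𝓝 0)) : Tendsto u atTop (𝓝 0) := by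
  have hcoord : ∀ j, Tendsto (fun k => u k j) atTop (𝓝 0) := by
    intro j
    have hc : 0 < ε / 2 * Lc j := mul_pos (half_pos h.eps_pos) (hLc j)
    rw [tendsto_zero_iff_norm_tendsto_zero]
    have h1 : Tendsto (fun k => ‖u k j‖ ^ 2) atTop (𝓝 0) := by
      refine squeeze_zero (fun k => sq_nonneg _) (fun k => ?_)
        (by simpa only [mul_zero] using hdev.const_mul (ε / 2 * Lc j)⁻¹)
      rw [← div_eq_inv_mul, le_div_iff₀ hc, mul_comm]
      exact h.norm_u_sq_le hLc k j
    simpa using h1.sqrt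
  exact ((PiLp.continuous_toLp 2 fun _ : Fin m => H).tendsto 0).comp (tendsto_pi_nhds.mpr hcoord)

theorem IsGenerated.lyapunov (hgen : IsGenerated F B Lc M S C Q θ γ ξ x z u v)
    (h : MatrixAssumption θ Lc M S C Q) (hpar : ParameterAssumption ε θ γ ξ) (hn : 2 ≤ n)
    (hF : ∀ i, MaximallyMonotone (F i)) (hLc : ∀ j, 0 < Lc j)
    (hB : ∀ j, Cocoercive (1 / Lc j) (B j)) {p : HilbertPow H (n - 1)} {a : H}
    (hp : IsSol F B M S C p a) :
    Summable (lSq γ z v) ∧ Tendsto (deviationSq θ Lc γ u v) atTop (𝓝 0) ∧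
      ∃ l, Tendsto (fun k => ‖z k - p‖) atTop (𝓝 l) := by
  have hS := h.S_diag_pos hn hpar.theta_pos hLc
  obtain ⟨h1, h2, c, h3⟩ := summable_and_tendsto_of_lyapunov hpar.eps_pos
    (a := fun k => ‖z k - p‖ ^ 2) (e := deviationSq θ Lc γ u v) (l := lSq γ z v)
    (fun k => sq_nonneg _)
    (fun k => (mul_nonneg hpar.eps_pos.le (sq_nonneg _)).trans (hpar.norm_v_sq_le hLc k))
    hpar.lSq_nonneg (fun k => (hpar.xi_mem k).2)
    (fun k => by
      have h4 := norm_sub_sq_le_of_step (hpar.gamma_pos k) (hpar.gamma_lt_one k) (hgen.z_succ k)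
        (hp.norm_sq_le h hpar.theta_pos hLc hF hB (hgen.dualVec_mem h.causal hS k))
      simp only [lSq, deviationSq]
      linarith)
    hgen.deviation_le
  exact ⟨h1, h2, √c, by simpa using h3.sqrt⟩

/-- The bounds on `γ` give `(1 - γ) / γ ≥ ε` and `γ / (1 - γ) ≤ 1 / ε`, so neither weight in `lSq`
degenerates. -/
theorem ParameterAssumption.tendsto_sub (h : ParameterAssumption ε θ γ ξ)
    (hl : Summable (lSq γ z v)) (hv : Tendsto v atTop (𝓝 0)) :
    Tendsto (fun k => z (k + 1) - z k) atTop (𝓝 0) := by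
  have h1 : Tendsto (fun k => z (k + 1) - z k + (γ k / (1 - γ k)) • v k) atTop (𝓝 0) := by
    rw [tendsto_zero_iff_norm_tendsto_zero]
    have h2 : Tendsto (fun k => ‖z (k + 1) - z k + (γ k / (1 - γ k)) • v k‖ ^ 2) atTop (𝓝 0) := by
      refine squeeze_zero (fun k => sq_nonneg _) (fun k => ?_)
        (by simpa using hl.tendsto_atTop_zero.const_mul ε⁻¹)
      rw [← div_eq_inv_mul, le_div_iff₀ h.eps_pos, mul_comm]
      refine mul_le_mul_of_nonneg_right ?_ (sq_nonneg _)
      rw [le_div_iff₀ (h.gamma_pos k)]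
      nlinarith [h.eps_le k, h.gamma_lt_one k, h.eps_pos]
    simpa using h2.sqrt
  have h3 : Tendsto (fun k => (γ k / (1 - γ k)) • v k) atTop (𝓝 0) := by
    refine squeeze_zero_norm (fun k => ?_) (by simpa using hv.norm.const_mul ε⁻¹)
    have h4 := h.gamma_pos k
    have h5 := h.gamma_lt_one k
    have h6 : 0 < 1 - γ k := by linarith
    rw [norm_smul, Real.norm_of_nonneg (by positivity)]
    refine mul_le_mul_of_nonneg_right ?_ (norm_nonneg _)
    rw [div_le_iff₀ h6, ← div_eq_inv_mul, le_div_iff₀ h.eps_pos]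
    nlinarith [h.eps_le k]
  simpa using h1.sub h3

theorem IsGenerated.tendsto_kron_transpose (hgen : IsGenerated F B Lc M S C Q θ γ ξ x z u v)
    (h : ParameterAssumption ε θ γ ξ) (hz : Tendsto (fun k => z (k + 1) - z k) atTop (𝓝 0)) :
    Tendsto (fun k => kron Mᵀ (x k)) atTop (𝓝 0) := by
  refine squeeze_zero_norm (fun k => ?_) (by simpa using hz.norm.const_mul ε⁻¹)
  have h1 : z (k + 1) - z k = -(γ k • kron Mᵀ (x k)) := by
    rw [hgen.z_succ k]
    abel
  rw [h1, norm_neg, norm_smul, Real.norm_of_nonneg (h.gamma_pos k).le, ← div_eq_inv_mul,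
    le_div_iff₀ h.eps_pos, mul_comm]
  exact mul_le_mul_of_nonneg_right (h.gamma_mem k).1 (norm_nonneg _)

theorem MatrixAssumption.tendsto_sum_smul (h : MatrixAssumption θ Lc M S C Q) (hn : 2 ≤ n)
    (hx : Tendsto (fun k => kron Mᵀ (x k)) atTop (𝓝 0)) {s : Fin n → ℝ} (hs : ∑ i, s i = 0) :
    Tendsto (fun k => ∑ i, s i • x k i) atTop (𝓝 0) := by
  have h1 := h.tendsto_kron_zero hn hx (P := Matrix.of fun _ : Fin 1 => s) (by
    ext
    simpa [Matrix.mulVec, dotProduct] using hs)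
  exact ((PiLp.continuous_apply 2 (fun _ : Fin 1 => H) 0).tendsto 0).comp h1

end Convergence

end DeviationFBS

end

theorem mainTheorem1 {H : Type*} [NormedAddCommGroup H] [InnerProductSpace ℝ H] [CompleteSpace H]
    (n m : ℕ) (hn : 2 ≤ n)
    (F : Fin n → H → Set H) (hF : ∀ i, MaximallyMonotone (F i))
    (B : Fin m → H → H) (Lc : Fin m → ℝ) (hLc : ∀ j, 0 < Lc j)
    (hB : ∀ j, Cocoercive (1 / Lc j) (B j))
    (hzer : (zer (∑ i, F i + ∑ j, singleValued (B j))).Nonempty)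
    (ε θ : ℝ) (γ ξ : ℕ → ℝ) (hpar : ParameterAssumption ε θ γ ξ)
    (M : Matrix (Fin n) (Fin (n - 1)) ℝ) (S : Matrix (Fin n) (Fin n) ℝ)
    (C : Matrix (Fin n) (Fin m) ℝ) (Q : Matrix (Fin m) (Fin n) ℝ)
    (hmat : MatrixAssumption θ Lc M S C Q)
    (x : ℕ → HilbertPow H n) (z : ℕ → HilbertPow H (n - 1))
    (u : ℕ → HilbertPow H m) (v : ℕ → HilbertPow H (n - 1))
    (hgen : IsGenerated F B Lc M S C Q θ γ ξ x z u v)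
    (γ₀ : ℝ) (hγ₀ : 0 < γ₀) :
    (Summable (lSq γ z v) ∧ Tendsto u atTop (𝓝 0) ∧ Tendsto v atTop (𝓝 0)) ∧
    (∀ p ∈ fixedPts (opT F B M S C Q γ₀),
      ∃ l : ℝ, Tendsto (fun k => ‖z k - p‖) atTop (𝓝 l)) ∧
    (Tendsto (fun k => z (k + 1) - z k) atTop (𝓝 0) ∧
      ∀ s : Fin n → ℝ, ∑ i, s i = 0 →
        Tendsto (fun k => ∑ i, s i • x k i) atTop (𝓝 0)) ∧
    (∃ p ∈ fixedPts (opT F B M S C Q γ₀), WeaklyConverges z p) ∧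
    (∃ a ∈ zer (∑ i, F i + ∑ j, singleValued (B j)),
      WeaklyConverges x (WithLp.toLp 2 fun _ => a)) := by
  have hS := hmat.S_diag_pos hn hpar.theta_pos hLc
  have hlyap := fun (p : HilbertPow H (n - 1)) (a : H) (hp : IsSol F B M S C p a) =>
    hgen.lyapunov hmat hpar hn hF hLc hB hp
  obtain ⟨a₀, ha₀⟩ := hzer
  obtain ⟨p₀, hp₀⟩ := exists_isSol hmat hn ha₀
  obtain ⟨hl, hdev, l₀, hl₀⟩ := hlyap p₀ a₀ hp₀
  have hu := hpar.tendsto_u hLc hdev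
  have hv := hpar.tendsto_v hLc hdev
  have hdz := hpar.tendsto_sub hl hv
  have hMx := hgen.tendsto_kron_transpose hpar hdz
  have hmem := hgen.dualVec_mem hmat.causal hS
  have hdist : ∀ p ∈ fixedPts (opT F B M S C Q γ₀),
      ∃ l : ℝ, Tendsto (fun k => ‖z k - p‖) atTop (𝓝 l) := by
    intro p hp
    obtain ⟨a, ha⟩ := (mem_fixedPts_iff hmat hn hS hγ₀).mp hp
    exact (hlyap p a ha).2.2
  obtain ⟨rz, hrz⟩ : ∃ r, ∀ k, ‖z k‖ ≤ r := by
    obtain ⟨r, hr⟩ := hl₀.bddAbove_range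
    refine ⟨‖p₀‖ + r, fun k => (norm_le_insert' (z k) p₀).trans ?_⟩
    gcongr
    exact hr ⟨k, rfl⟩
  obtain ⟨rv, hrv⟩ := exists_norm_le_of_tendsto hv
  have hrw : ∀ k, ‖z k + v k‖ ≤ rz + rv := fun k =>
    (norm_add_le _ _).trans (add_le_add (hrz k) (hrv k))
  obtain ⟨rx, hrx⟩ := exists_norm_le_of_dualVec_mem hmat hn hS hF hp₀ hrw hMx hmem
  have hclus : ∀ (U : Ultrafilter ℕ) (p : HilbertPow H (n - 1)), (U : Filter ℕ) ≤ atTop →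
      WeakLim U z p → ∃ a, IsSol F B M S C p a ∧ WeakLim U x (diagVec n a) := by
    intro U p hU hp
    have h1 := hp.add (weakLim_of_tendsto (hv.mono_left hU))
    rw [add_zero] at h1
    exact exists_isSol_of_weakLim hmat hn hF hLc hB hrw hu hrx hMx hmem hU h1
  obtain ⟨p, hpfix, hzp⟩ := exists_weakLim_of_fejer hrz hdist fun U p hU hp =>
    (mem_fixedPts_iff hmat hn hS hγ₀).mpr ((hclus U p hU hp).imp fun _ h => h.1)
  obtain ⟨a, ha⟩ := (mem_fixedPts_iff hmat hn hS hγ₀).mp hpfix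
  refine ⟨⟨hl, hu, hv⟩, hdist, ⟨hdz, fun s hs => hmat.tendsto_sum_smul hn hMx hs⟩,
    ⟨p, hpfix, weaklyConverges_iff.mpr hzp⟩, ⟨a, ha.mem_zer hmat, weaklyConverges_iff.mpr ?_⟩⟩
  intro w
  refine (tendsto_iff_ultrafilter _ _ _).mpr fun U hU => ?_
  -- Every ultrafilter limit of `x` comes with the same dual limit `p`, and `p` determines the
  -- primal point.
  obtain ⟨a', ha', hxa'⟩ := hclus U p hU fun w' => (hzp w').mono_left hU
  rw [ha.unique hmat.causal hn hS hF ha']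
  exact hxa' w
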